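/- **Theorem.** Let $u,p$ be a classical solution ($u$ of class $C^2$ on $\mathbb R^3\times[0,T)$, $p(\cdot,t)$ differentiable) of the three-dimensional incompressible Euler equations $u_t+(u\cdot\nabla)u=-\nabla p$, $\nabla\cdot u=0$. Let $\omega=\nabla\times u$, $\xi=\omega/|\omega|$, $\kappa=|\xi\cdot\nabla\xi|$, $\tau=\nabla\cdot\xi$, let $T_0\in[0,T)$, and assume that $\Omega(t)=\|\omega(\cdot,t)\|_{L^\infty}<\infty$ for $t\in[T_0,T)$. For $t\in[T_0,T)$ let $L^t=\{x(s,t):0\le s\le L(t)\}$, $L(t)>0$, be vortex line segments which come from the same vortex line. That is, $\omega\ne0$ on $L^t$ and $\partial_s x(s,t)=\xi(x(s,t),t)$ (so $s$ is arclength); moreover there is a vortex line at time $T_0$, parametrized by arclength $\beta$ and carried by the flow, such that $x(s,t)$ is the position at time $t$ of the point with label $\beta=b(s,t)$, where $b$ is differentiable in $s$ and the labels $b(0,t)$, $b(L(t),t)$ of the end points are differentiable in $t$. Assume that the length $L(t)$ is non-increasing in $t$. Put $$\Omega_L(t)=\max_{L^t}|\omega(\cdot,t)|,\quad V(t)=\max_{L^t}|u\cdot\xi|,\quad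 Q(t)=\frac1{L(t)}\int_0^{L(t)}|\omega(x(s,t),t)|\,ds .$$ Suppose that there are constants $0<c_0\le1$ and $C_0,C_l,C_u>0$ such that for all $t\in[T_0,T)$ $$\Omega_L(t)\ge c_0\,\Omega(t),\qquad |\omega(x(L(t),t),t)|=\Omega_L(t),$$ $$\int_{L^t}|\kappa|\,ds\le C_0,\qquad \int_{L^t}|\tau|\,ds\le C_0,\qquad \Big|\frac{d x(0,t)}{dt}\cdot\xi(x(0,t),t)\Big|\le C_l\,V(t),$$ $$\max_{x\in L^t}|u(x,t)|\le C_u\log\Omega(t).$$ Then for all $t\in[T_0,T)$ $$\Omega(t)\le\exp\left(\log\Big(\frac{C_1}{c_0}Q(T_0)\Big)\exp\Big(\int_{T_0}^t\frac{C}{L(t')}\,dt'\Big)\right),$$ where $C_1=e^{C_0}$, $C=C_u\max(C_U,C_V)$, $C_U=C_0(2C_1-1)$ and $C_V=2C_0C_1+(C_1-1)(C_l+1)+2C_1$. -/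

import Mathlib

open Set MeasureTheory
open scoped ENNReal

noncomputable section

/-- Three-dimensional Euclidean space. -/
abbrev E3 : Type := EuclideanSpace ℝ (Fin 3)

/-- `pd v i j x` is the partial derivative in direction `i` of the `j`-th component of `v` at `x`. -/
def pd (v : E3 → E3) (i j : Fin 3) (x : E3) : ℝ :=
  fderiv ℝ v x (EuclideanSpace.single i 1) j

/-- The curl of a vector field. -/
def curl (v : E3 → E3) (x : E3) : E3 :=
  !₂[pd v 1 2 x - pd v 2 1 x, pd v 2 0 x - pd v 0 2 x, pd v 0 1 x - pd v 1 0 x]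

/-- The divergence of a vector field. -/
def divergence (v : E3 → E3) (x : E3) : ℝ := ∑ i, pd v i i x

/-- `(u, p)` is a classical solution on `ℝ³ × [0, T)` of the incompressible Euler equations
`u_t + (u · ∇) u = -∇p`, `∇ · u = 0`  (`u t x` is the velocity and `p t x` the pressure). -/
structure IsEulerSolution (T : ℝ) (u : ℝ → E3 → E3) (p : ℝ → E3 → ℝ) : Prop where
  contDiffOn : ContDiffOn ℝ 2 (fun q : ℝ × E3 => u q.1 q.2) (Ico 0 T ×ˢ univ)
  pressure : ∀ t ∈ Ico 0 T, Differentiable ℝ (p t)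
  momentum : ∀ t ∈ Ico 0 T, ∀ x : E3,
    derivWithin (fun t' => u t' x) (Ico 0 T) t + fderiv ℝ (u t) x (u t x) = -gradient (p t) x
  incompressible : ∀ t ∈ Ico 0 T, ∀ x : E3, divergence (u t) x = 0

/-- The vorticity `ω = ∇ × u`. -/
def vorticity (u : ℝ → E3 → E3) (t : ℝ) (x : E3) : E3 := curl (u t) x

/-- The unit vorticity vector `ξ = ω / |ω|`. -/
def xi (u : ℝ → E3 → E3) (t : ℝ) (x : E3) : E3 :=
  ‖vorticity u t x‖⁻¹ • vorticity u t x

/-- The unsigned curvature `κ = |ξ · ∇ξ|` of the vortex lines. -/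
def kappa (u : ℝ → E3 → E3) (t : ℝ) (x : E3) : ℝ :=
  ‖fderiv ℝ (xi u t) x (xi u t x)‖

/-- `τ = ∇ · ξ`. -/
def tau (u : ℝ → E3 → E3) (t : ℝ) (x : E3) : ℝ := divergence (xi u t) x

/-- The maximum vorticity `Ω(t) = ‖ω(t)‖_{L^∞}`. -/
def Omega (u : ℝ → E3 → E3) (t : ℝ) : ℝ := (eLpNorm (vorticity u t) ∞ volume).toReal

/-- `I` is an interval and `Y β t`, for `β ∈ I`, is the position at time `t ∈ [T₀, T)` of the point
`β` of a line that is carried by the flow of `u` and that is, at the time `T₀`, a vortex line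
parametrized by arclength. -/
structure IsCarriedVortexLine (u : ℝ → E3 → E3) (T₀ T : ℝ) (I : Set ℝ) (Y : ℝ → ℝ → E3) :
    Prop where
  ordConnected : I.OrdConnected
  initial_ne_zero : ∀ β ∈ I, vorticity u T₀ (Y β T₀) ≠ 0
  initial : ∀ β ∈ I, HasDerivWithinAt (fun β' => Y β' T₀) (xi u T₀ (Y β T₀)) I β
  carried : ∀ β ∈ I, ∀ t ∈ Ico T₀ T, HasDerivWithinAt (Y β) (u t (Y β t)) (Ico T₀ T) t

/-- `L^t = {x(s,t) : 0 ≤ s ≤ L(t)}`, `t ∈ [T₀, T)`, is a family of vortex line segments, with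
arclength `s`, which come from the same vortex line: `x(s,t)` is the position at time `t` of the
point with label `b(s,t)` of one vortex line carried by the flow. The labels of the two end points
are differentiable functions of time. -/
structure IsVortexSegmentFamily (u : ℝ → E3 → E3) (T₀ T : ℝ) (x : ℝ → ℝ → E3) (L : ℝ → ℝ) :
    Prop where
  length_pos : ∀ t ∈ Ico T₀ T, 0 < L t
  vorticity_ne_zero : ∀ t ∈ Ico T₀ T, ∀ s ∈ Icc 0 (L t), vorticity u t (x s t) ≠ 0
  tangent : ∀ t ∈ Ico T₀ T, ∀ s ∈ Icc 0 (L t),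
    HasDerivWithinAt (fun s' => x s' t) (xi u t (x s t)) (Icc 0 (L t)) s
  same_line : ∃ (I : Set ℝ) (Y : ℝ → ℝ → E3) (b : ℝ → ℝ → ℝ),
    IsCarriedVortexLine u T₀ T I Y ∧
    (∀ t ∈ Ico T₀ T, ∀ s ∈ Icc 0 (L t), b s t ∈ I ∧ x s t = Y (b s t) t) ∧
    (∀ t ∈ Ico T₀ T, DifferentiableOn ℝ (fun s => b s t) (Icc 0 (L t))) ∧
    DifferentiableOn ℝ (fun t => b 0 t) (Ico T₀ T) ∧
    DifferentiableOn ℝ (fun t => b (L t) t) (Ico T₀ T)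

/-- The maximum over `L^t` of the function `f` of the position. -/
def segMax (x : ℝ → ℝ → E3) (L : ℝ → ℝ) (t : ℝ) (f : E3 → ℝ) : ℝ :=
  sSup ((fun s => f (x s t)) '' Icc 0 (L t))

/-- The integral `∫_{L^t} f ds`. -/
def segIntegral (x : ℝ → ℝ → E3) (L : ℝ → ℝ) (t : ℝ) (f : E3 → ℝ) : ℝ :=
  ∫ s in (0 : ℝ)..L t, f (x s t)

/-- The maximum `Ω_L(t)` of `|ω|` over `L^t`. -/
def OmegaL (u : ℝ → E3 → E3) (x : ℝ → ℝ → E3) (L : ℝ → ℝ) (t : ℝ) : ℝ :=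
  segMax x L t fun y => ‖vorticity u t y‖

/-- `V(t)`, the maximum of `|u · ξ|` over `L^t`. -/
def Vmax (u : ℝ → E3 → E3) (x : ℝ → ℝ → E3) (L : ℝ → ℝ) (t : ℝ) : ℝ :=
  segMax x L t fun y => |inner ℝ (u t y) (xi u t y)|

/-- `Q(t)`, the mean of `|ω|` over `L^t`. -/
def meanVorticity (u : ℝ → E3 → E3) (x : ℝ → ℝ → E3) (L : ℝ → ℝ) (t : ℝ) : ℝ :=
  1 / L t * segIntegral x L t fun y => ‖vorticity u t y‖

/-- `C_U = C₀ (2 C₁ - 1)` with `C₁ = exp C₀`. -/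
def constCU (C₀ : ℝ) : ℝ := C₀ * (2 * Real.exp C₀ - 1)

/-- `C_V = 2 C₀ C₁ + (C₁ - 1) (C_l + 1) + 2 C₁` with `C₁ = exp C₀`. -/
def constCV (C₀ Cl : ℝ) : ℝ :=
  2 * C₀ * Real.exp C₀ + (Real.exp C₀ - 1) * (Cl + 1) + 2 * Real.exp C₀

end

noncomputable section

open Filter Topology Asymptotics

/-! The plan is to derive a linear differential inequality for `y = log ((C₁ / c₀) Q)`. Since `|ω|`
varies by at most a factor `C₁` along a segment, `Ω ≤ (C₁ / c₀) Q = exp y`, so a bound on `y`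
suffices.

Vorticity is frozen into the flow: a carried vortex line stays a vortex line, with arclength element
`ds = (|ω| / |ω₀|) dβ` (`IsCarriedVortexLine.hasDerivWithinAt_label`). In the fixed label `β`, `L =
∫ ds` and `N = ∫ |ω| ds` can be differentiated in time
(`IsVortexSegmentFamily.exists_hasDerivWithinAt`). With `g = |ω|`, the stretching rate `α = ξ · ∇u
ξ`, and end point speeds `σ₀`, `σ₁` relative to the flow, `L' = ∫ α + σ₁ - σ₀` and `N' = ∫ 2 α g +
g(L) σ₁ - g(0) σ₀`.

Nothing bounds `σ₁` directly, but it cancels in `N' - M L' = ∫ α (2 g - M) + σ₀ (M - g(0))`, where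
`M = g(L)` is the maximum. Since `Q ≤ M` and `L' ≤ 0`, `L Q' = N' - Q L' ≤ N' - M L'`.

The right side is estimated in `integral_stretching_le`. Along the line `α = (u · ξ)' - u · (ξ ·
∇ξ)`, and `∇ · ω = 0` gives `g' = -τ g`. Integrating by parts removes all derivatives of `u`, and
the bounds on `∫ |κ|` and `∫ |τ|` yield `C_V U Q`, where `U` is the maximum of `|u|` on the segment.
As `U ≤ C_u log Ω ≤ C_u y`, this gives `y' ≤ (C / L) y`, and Grönwall's inequality
(`le_mul_exp_integral_of_hasDerivAt_le`) concludes. -/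

/-! ### Linear algebra of the curl. -/

/-- The curl as a linear function of the derivative. -/
def curlLinear : (E3 →L[ℝ] E3) →L[ℝ] E3 :=
  LinearMap.toContinuousLinearMap
    { toFun := fun A => !₂[A (EuclideanSpace.single 1 1) 2 - A (EuclideanSpace.single 2 1) 1,
        A (EuclideanSpace.single 2 1) 0 - A (EuclideanSpace.single 0 1) 2,
        A (EuclideanSpace.single 0 1) 1 - A (EuclideanSpace.single 1 1) 0]
      map_add' := fun A B => by
        ext i; fin_cases i <;> simp <;> ring
      map_smul' := fun c A => by
        ext i; fin_cases i <;> simp <;> ring }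

theorem curl_eq_curlLinear (v : E3 → E3) (x : E3) : curl v x = curlLinear (fderiv ℝ v x) := rfl

theorem E3.eq_sum (v : E3) : v = v 0 • EuclideanSpace.single 0 (1 : ℝ)
    + v 1 • EuclideanSpace.single 1 (1 : ℝ) + v 2 • EuclideanSpace.single 2 (1 : ℝ) := by
  ext i; fin_cases i <;> simp

/-- Split `A = S + W` into symmetric and skew parts, with `w` the vector of `W`. The skew part of
`A²` is `SW + WS`, which for trace-free `S` represents `-S w`; and `A w = S w` because `W w = 0`.
The code checks this in coordinates. -/
theorem curlLinear_comp_self (A : E3 →L[ℝ] E3)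
    (hA : ∑ i, A (EuclideanSpace.single i 1) i = 0) :
    curlLinear (A.comp A) = -A (curlLinear A) := by
  have key : ∀ v : E3, A v = v 0 • A (EuclideanSpace.single 0 (1 : ℝ))
      + v 1 • A (EuclideanSpace.single 1 (1 : ℝ)) + v 2 • A (EuclideanSpace.single 2 (1 : ℝ)) := by
    intro v
    conv_lhs => rw [E3.eq_sum v]
    simp only [map_add, map_smul]
  rw [key (curlLinear A)]
  rw [Fin.sum_univ_three] at hA
  have h0 := key (A (EuclideanSpace.single 0 (1 : ℝ)))
  have h1 := key (A (EuclideanSpace.single 1 (1 : ℝ)))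
  have h2 := key (A (EuclideanSpace.single 2 (1 : ℝ)))
  simp only [curlLinear, LinearMap.coe_toContinuousLinearMap', LinearMap.coe_mk, AddHom.coe_mk,
    ContinuousLinearMap.comp_apply]
  rw [h0, h1, h2]
  generalize A (EuclideanSpace.single 0 (1 : ℝ)) = a0 at *
  generalize A (EuclideanSpace.single 1 (1 : ℝ)) = a1 at *
  generalize A (EuclideanSpace.single 2 (1 : ℝ)) = a2 at *
  have e : a0 0 = -(a1 1) - a2 2 := by linarith
  ext i; fin_cases i <;> simp [e] <;> ring

theorem curlLinear_eq_zero_of_symmetric (A : E3 →L[ℝ] E3)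
    (hA : ∀ v w, inner ℝ (A v) w = inner ℝ (A w) v) : curlLinear A = 0 := by
  have h : ∀ i j : Fin 3, A (EuclideanSpace.single i 1) j = A (EuclideanSpace.single j 1) i := by
    intro i j
    simpa [EuclideanSpace.inner_single_right] using
      hA (EuclideanSpace.single i 1) (EuclideanSpace.single j 1)
  ext i; fin_cases i <;> simp [curlLinear, h 1 2, h 2 0, h 0 1]

/-! ### The vorticity equation for a classical solution. -/

/-- The velocity as a function of space and time. -/
def spaceTime (u : ℝ → E3 → E3) (q : ℝ × E3) : E3 := u q.1 q.2

/-- The derivative of the velocity in space and time. -/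
def spaceTimeDeriv (T : ℝ) (u : ℝ → E3 → E3) (q : ℝ × E3) : ℝ × E3 →L[ℝ] E3 :=
  fderivWithin ℝ (spaceTime u) (Ico 0 T ×ˢ univ) q

/-- The second derivative of the velocity in space and time. -/
def spaceTimeDeriv2 (T : ℝ) (u : ℝ → E3 → E3) (q : ℝ × E3) : ℝ × E3 →L[ℝ] ℝ × E3 →L[ℝ] E3 :=
  fderivWithin ℝ (spaceTimeDeriv T u) (Ico 0 T ×ˢ univ) q

/-- The velocity gradient. -/
def velGrad (T : ℝ) (u : ℝ → E3 → E3) (q : ℝ × E3) : E3 →L[ℝ] E3 :=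
  (spaceTimeDeriv T u q).comp (ContinuousLinearMap.inr ℝ ℝ E3)

theorem uniqueDiffOn_slab (T : ℝ) : UniqueDiffOn ℝ (Ico 0 T ×ˢ (univ : Set E3)) :=
  (uniqueDiffOn_Ico 0 T).prod uniqueDiffOn_univ

namespace IsEulerSolution

variable {T : ℝ} {u : ℝ → E3 → E3} {p : ℝ → E3 → ℝ} {t : ℝ}

theorem contDiffOn_spaceTime (hu : IsEulerSolution T u p) :
    ContDiffOn ℝ 2 (spaceTime u) (Ico 0 T ×ˢ univ) := hu.contDiffOn

theorem contDiffOn_spaceTimeDeriv (hu : IsEulerSolution T u p) :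
    ContDiffOn ℝ 1 (spaceTimeDeriv T u) (Ico 0 T ×ˢ univ) :=
  hu.contDiffOn_spaceTime.fderivWithin (uniqueDiffOn_slab T) (by norm_num)

theorem continuousOn_spaceTimeDeriv2 (hu : IsEulerSolution T u p) :
    ContinuousOn (spaceTimeDeriv2 T u) (Ico 0 T ×ˢ univ) :=
  hu.contDiffOn_spaceTimeDeriv.continuousOn_fderivWithin (uniqueDiffOn_slab T) le_rfl

theorem hasFDerivWithinAt_spaceTime (hu : IsEulerSolution T u p) {q : ℝ × E3}
    (hq : q ∈ Ico 0 T ×ˢ (univ : Set E3)) :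
    HasFDerivWithinAt (spaceTime u) (spaceTimeDeriv T u q) (Ico 0 T ×ˢ univ) q :=
  (hu.contDiffOn_spaceTime.differentiableOn (by norm_num) q hq).hasFDerivWithinAt

theorem hasFDerivWithinAt_spaceTimeDeriv (hu : IsEulerSolution T u p) {q : ℝ × E3}
    (hq : q ∈ Ico 0 T ×ˢ (univ : Set E3)) :
    HasFDerivWithinAt (spaceTimeDeriv T u) (spaceTimeDeriv2 T u q) (Ico 0 T ×ˢ univ) q :=
  (hu.contDiffOn_spaceTimeDeriv.differentiableOn (by norm_num) q hq).hasFDerivWithinAt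

/-- The slab is not open at time `0`, but each of its points is in the closure of its interior,
which is enough for symmetry of the second derivative within it. -/
theorem spaceTimeDeriv2_symm (hu : IsEulerSolution T u p) {q : ℝ × E3}
    (hq : q ∈ Ico 0 T ×ˢ (univ : Set E3)) (v w : ℝ × E3) :
    spaceTimeDeriv2 T u q v w = spaceTimeDeriv2 T u q w v := by
  have h : IsSymmSndFDerivWithinAt ℝ (spaceTime u) (Ico 0 T ×ˢ univ) q := by
    refine (hu.contDiffOn_spaceTime q hq).isSymmSndFDerivWithinAt (by simp)
      (uniqueDiffOn_slab T) ?_ hq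
    have hT : (0 : ℝ) < T := lt_of_le_of_lt hq.1.1 hq.1.2
    rw [interior_prod_eq, closure_prod_eq, interior_Ico, closure_Ioo hT.ne]
    exact ⟨Ico_subset_Icc_self hq.1, by simp⟩
  exact h v w

theorem hasFDerivAt_space {F : Type*} [NormedAddCommGroup F] [NormedSpace ℝ F]
    {f : ℝ × E3 → F} {f' : ℝ × E3 →L[ℝ] F} (ht : t ∈ Ico 0 T) {x : E3}
    (hf : HasFDerivWithinAt f f' (Ico 0 T ×ˢ univ) (t, x)) :
    HasFDerivAt (fun y => f (t, y)) (f'.comp (ContinuousLinearMap.inr ℝ ℝ E3)) x := by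
  have h := HasFDerivWithinAt.comp (t := Ico 0 T ×ˢ univ) (s := univ) x hf
    (hasFDerivAt_prodMk_right t x).hasFDerivWithinAt (fun y _ => ⟨ht, mem_univ _⟩)
  exact hasFDerivWithinAt_univ.1 h

theorem hasFDerivAt (hu : IsEulerSolution T u p) (ht : t ∈ Ico 0 T) (x : E3) :
    HasFDerivAt (u t) (velGrad T u (t, x)) x :=
  hasFDerivAt_space ht (hu.hasFDerivWithinAt_spaceTime ⟨ht, mem_univ _⟩)

theorem fderiv_eq (hu : IsEulerSolution T u p) (ht : t ∈ Ico 0 T) (x : E3) :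
    fderiv ℝ (u t) x = velGrad T u (t, x) := (hu.hasFDerivAt ht x).fderiv

theorem derivWithin_eq (hu : IsEulerSolution T u p) (ht : t ∈ Ico 0 T) (x : E3) :
    derivWithin (fun t' => u t' x) (Ico 0 T) t = spaceTimeDeriv T u (t, x) (1, 0) := by
  have h := HasFDerivWithinAt.comp_hasDerivWithinAt (t := Ico 0 T ×ˢ univ) (s := Ico 0 T) t
    (hu.hasFDerivWithinAt_spaceTime (q := (t, x)) ⟨ht, mem_univ _⟩)
    ((hasDerivWithinAt_id t (Ico 0 T)).prodMk (hasDerivWithinAt_const t (Ico 0 T) x))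
    (fun s hs => ⟨hs, mem_univ _⟩)
  exact h.derivWithin (uniqueDiffOn_Ico 0 T t ht)

theorem vorticity_eq (hu : IsEulerSolution T u p) (ht : t ∈ Ico 0 T) (x : E3) :
    vorticity u t x = curlLinear (velGrad T u (t, x)) := by
  rw [vorticity, curl_eq_curlLinear, hu.fderiv_eq ht]

theorem momentum_eq (hu : IsEulerSolution T u p) (ht : t ∈ Ico 0 T) (x : E3) :
    gradient (p t) x = -spaceTimeDeriv T u (t, x) (1, u t x) := by
  have h := hu.momentum t ht x
  rw [hu.derivWithin_eq ht, hu.fderiv_eq ht] at h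
  rw [eq_comm, neg_eq_iff_eq_neg, ← h, velGrad]
  simp [← map_add]

/-- Symmetry of the second derivative puts the direction `(1, u)` first, so the first summand is the
material derivative of `∇u`. -/
theorem hasFDerivAt_acceleration (hu : IsEulerSolution T u p) (ht : t ∈ Ico 0 T) (x : E3) :
    HasFDerivAt (fun y => spaceTimeDeriv T u (t, y) (1, u t y))
      ((spaceTimeDeriv2 T u (t, x) (1, u t x)).comp (ContinuousLinearMap.inr ℝ ℝ E3)
        + (velGrad T u (t, x)).comp (velGrad T u (t, x))) x := by
  have h1 := hasFDerivAt_space ht (hu.hasFDerivWithinAt_spaceTimeDeriv (q := (t, x)) ⟨ht, mem_univ _⟩)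
  have h2 : HasFDerivAt (fun y => ((1 : ℝ), u t y))
      ((ContinuousLinearMap.inr ℝ ℝ E3).comp (velGrad T u (t, x))) x := by
    have h := (hasFDerivAt_const (1 : ℝ) x).prodMk (hu.hasFDerivAt ht x)
    have e : (0 : E3 →L[ℝ] ℝ).prod (velGrad T u (t, x))
        = (ContinuousLinearMap.inr ℝ ℝ E3).comp (velGrad T u (t, x)) := by
      ext v <;> simp
    rwa [e] at h
  refine (h1.clm_apply h2).congr_fderiv (ContinuousLinearMap.ext fun v => ?_)
  simp only [add_apply, ContinuousLinearMap.comp_apply,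
    ContinuousLinearMap.flip_apply]
  rw [add_comm, hu.spaceTimeDeriv2_symm ⟨ht, mem_univ _⟩]
  rfl

/-- The acceleration is `-∇p`. No second derivative of `p` is assumed: it exists because the
acceleration is differentiable, and it is then symmetric. -/
theorem curlLinear_acceleration (hu : IsEulerSolution T u p) (ht : t ∈ Ico 0 T) (x : E3) :
    curlLinear ((spaceTimeDeriv2 T u (t, x) (1, u t x)).comp (ContinuousLinearMap.inr ℝ ℝ E3)
        + (velGrad T u (t, x)).comp (velGrad T u (t, x))) = 0 := by
  refine curlLinear_eq_zero_of_symmetric _ fun v w => ?_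
  have hp : ∀ y, HasFDerivAt (p t) (innerSL ℝ (-spaceTimeDeriv T u (t, y) (1, u t y))) y := by
    intro y
    have := ((hu.pressure t ht) y).hasGradientAt.hasFDerivAt
    rw [hu.momentum_eq ht] at this
    exact this
  have hp2 := (innerSL ℝ (E := E3)).hasFDerivAt.comp x (hu.hasFDerivAt_acceleration ht x).neg
  have := second_derivative_symmetric (f' := fun y => innerSL ℝ (-spaceTimeDeriv T u (t, y) (1, u t y)))
    hp hp2 v w
  have h2 : -inner ℝ (((spaceTimeDeriv2 T u (t, x) (1, u t x)).comp (ContinuousLinearMap.inr ℝ ℝ E3)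
        + (velGrad T u (t, x)).comp (velGrad T u (t, x))) v) w =
      -inner ℝ (((spaceTimeDeriv2 T u (t, x) (1, u t x)).comp (ContinuousLinearMap.inr ℝ ℝ E3)
        + (velGrad T u (t, x)).comp (velGrad T u (t, x))) w) v := by
    rw [← inner_neg_left, ← inner_neg_left]
    exact this
  exact neg_injective h2

theorem sum_velGrad (hu : IsEulerSolution T u p) (ht : t ∈ Ico 0 T) (x : E3) :
    ∑ i, velGrad T u (t, x) (EuclideanSpace.single i 1) i = 0 := by
  rw [← hu.fderiv_eq ht]
  exact hu.incompressible t ht x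

theorem vorticity_equation (hu : IsEulerSolution T u p) (ht : t ∈ Ico 0 T) (x : E3) :
    curlLinear ((spaceTimeDeriv2 T u (t, x) (1, u t x)).comp (ContinuousLinearMap.inr ℝ ℝ E3))
      = velGrad T u (t, x) (vorticity u t x) := by
  have h := hu.curlLinear_acceleration ht x
  rw [map_add, curlLinear_comp_self _ (hu.sum_velGrad ht x), ← hu.vorticity_eq ht,
    ← sub_eq_add_neg, sub_eq_zero] at h
  exact h

/-- The derivative of the vorticity in space and time. -/
theorem hasFDerivWithinAt_vorticity (hu : IsEulerSolution T u p) {q : ℝ × E3}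
    (hq : q ∈ Ico 0 T ×ˢ (univ : Set E3)) :
    HasFDerivWithinAt (fun q : ℝ × E3 => vorticity u q.1 q.2)
      (curlLinear.comp (((ContinuousLinearMap.compL ℝ E3 (ℝ × E3) E3).flip
        (ContinuousLinearMap.inr ℝ ℝ E3)).comp (spaceTimeDeriv2 T u q))) (Ico 0 T ×ˢ univ) q := by
  have h := (curlLinear.comp ((ContinuousLinearMap.compL ℝ E3 (ℝ × E3) E3).flip
        (ContinuousLinearMap.inr ℝ ℝ E3))).hasFDerivAt.comp_hasFDerivWithinAt q
        (hu.hasFDerivWithinAt_spaceTimeDeriv hq)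
  exact h.congr (fun r hr => hu.vorticity_eq hr.1 r.2) (hu.vorticity_eq hq.1 q.2)

theorem continuousOn_spaceTime (hu : IsEulerSolution T u p) :
    ContinuousOn (fun q : ℝ × E3 => u q.1 q.2) (Ico 0 T ×ˢ univ) := hu.contDiffOn.continuousOn

theorem continuousOn_velGrad (hu : IsEulerSolution T u p) :
    ContinuousOn (velGrad T u) (Ico 0 T ×ˢ univ) :=
  hu.contDiffOn_spaceTimeDeriv.continuousOn.clm_comp continuousOn_const

theorem continuousOn_vorticity (hu : IsEulerSolution T u p) :
    ContinuousOn (fun q : ℝ × E3 => vorticity u q.1 q.2) (Ico 0 T ×ˢ univ) :=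
  fun _ hq => (hu.hasFDerivWithinAt_vorticity hq).continuousWithinAt

theorem contDiff_vorticity (hu : IsEulerSolution T u p) (ht : t ∈ Ico 0 T) :
    ContDiff ℝ 1 (vorticity u t) := by
  have h : ContDiff ℝ 1 (fun x : E3 => spaceTimeDeriv T u (t, x)) := by
    rw [← contDiffOn_univ]
    exact hu.contDiffOn_spaceTimeDeriv.comp (contDiff_prodMk_right t).contDiffOn
      (fun y _ => ⟨ht, mem_univ _⟩)
  have h2 : vorticity u t = fun x => curlLinear (velGrad T u (t, x)) :=
    funext fun x => hu.vorticity_eq ht x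
  rw [h2]
  exact curlLinear.contDiff.comp (h.clm_comp contDiff_const)

theorem hasFDerivAt_vorticity (hu : IsEulerSolution T u p) (ht : t ∈ Ico 0 T) (x : E3) :
    HasFDerivAt (vorticity u t) ((curlLinear.comp (((ContinuousLinearMap.compL ℝ E3 (ℝ × E3) E3).flip
        (ContinuousLinearMap.inr ℝ ℝ E3)).comp (spaceTimeDeriv2 T u (t, x)))).comp
        (ContinuousLinearMap.inr ℝ ℝ E3)) x :=
  hasFDerivAt_space ht (hu.hasFDerivWithinAt_vorticity (q := (t, x)) ⟨ht, mem_univ _⟩)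

theorem divergence_vorticity (hu : IsEulerSolution T u p) (ht : t ∈ Ico 0 T) (x : E3) :
    divergence (vorticity u t) x = 0 := by
  have hs := fun v w => hu.spaceTimeDeriv2_symm (q := (t, x)) ⟨ht, mem_univ _⟩ v w
  simp only [divergence, pd, (hu.hasFDerivAt_vorticity ht x).fderiv, Fin.sum_univ_three]
  simp [curlLinear]
  rw [hs (0, EuclideanSpace.single 1 1) (0, EuclideanSpace.single 0 1),
    hs (0, EuclideanSpace.single 2 1) (0, EuclideanSpace.single 0 1),
    hs (0, EuclideanSpace.single 2 1) (0, EuclideanSpace.single 1 1)]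
  ring

/-- The vorticity is stretched by the velocity gradient along particle paths. -/
theorem hasDerivWithinAt_vorticity (hu : IsEulerSolution T u p) (ht : t ∈ Ico 0 T) {s : Set ℝ}
    (hs : s ⊆ Ico 0 T) {y : ℝ → E3} (hy : HasDerivWithinAt y (u t (y t)) s t) :
    HasDerivWithinAt (fun t => vorticity u t (y t))
      (velGrad T u (t, y t) (vorticity u t (y t))) s t := by
  have h := HasFDerivWithinAt.comp_hasDerivWithinAt (t := Ico 0 T ×ˢ univ) (s := s) t
    (hu.hasFDerivWithinAt_vorticity (q := (t, y t)) ⟨ht, mem_univ _⟩)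
    ((hasDerivWithinAt_id t s).prodMk hy)
    (fun s hs' => ⟨hs hs', mem_univ _⟩)
  rw [← hu.vorticity_equation ht]
  exact h

end IsEulerSolution

/-! ### Vortex lines are carried by the flow. -/

namespace IsEulerSolution

variable {T : ℝ} {u : ℝ → E3 → E3} {p : ℝ → E3 → ℝ} {t : ℝ}

/-- On bounded sets and compact time intervals, the velocity is Lipschitz and its first order Taylor
expansion in space has a uniformly quadratic remainder. -/
theorem exists_taylor_bound (hu : IsEulerSolution T u p) {a b : ℝ} (hab : Icc a b ⊆ Ico 0 T)
    (R : ℝ) : ∃ K > 0, ∀ t ∈ Icc a b, ∀ x ∈ Metric.closedBall (0 : E3) R,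
      ‖velGrad T u (t, x)‖ ≤ K ∧ ∀ y ∈ Metric.closedBall (0 : E3) R,
      ‖u t y - u t x‖ ≤ K * ‖y - x‖ ∧
      ‖u t y - u t x - velGrad T u (t, x) (y - x)‖ ≤ K * ‖y - x‖ * ‖y - x‖ := by
  have hcpt : IsCompact (Icc a b ×ˢ Metric.closedBall (0 : E3) R) :=
    isCompact_Icc.prod (isCompact_closedBall _ _)
  have hsub : Icc a b ×ˢ Metric.closedBall (0 : E3) R ⊆ Ico 0 T ×ˢ univ :=
    prod_mono hab (subset_univ _)
  obtain ⟨K₁, hK₁⟩ := hcpt.exists_bound_of_continuousOn (hu.continuousOn_velGrad.mono hsub)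
  have hc : ContinuousOn (fun q => ((((ContinuousLinearMap.compL ℝ E3 (ℝ × E3) E3).flip
      (ContinuousLinearMap.inr ℝ ℝ E3)).comp (spaceTimeDeriv2 T u q)).comp
      (ContinuousLinearMap.inr ℝ ℝ E3))) (Ico 0 T ×ˢ univ) :=
    (continuousOn_const.clm_comp hu.continuousOn_spaceTimeDeriv2).clm_comp continuousOn_const
  obtain ⟨K₂, hK₂⟩ := hcpt.exists_bound_of_continuousOn (hc.mono hsub)
  have hK : 0 < max (max K₁ K₂) 1 := lt_max_of_lt_right one_pos
  refine ⟨max (max K₁ K₂) 1, hK, fun t ht x hx => ?_⟩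
  set K := max (max K₁ K₂) 1
  have hK₁' : ∀ y ∈ Metric.closedBall (0 : E3) R, ‖velGrad T u (t, y)‖ ≤ K := fun y hy =>
    (hK₁ (t, y) ⟨ht, hy⟩).trans ((le_max_left _ _).trans (le_max_left _ _))
  have hconv : Convex ℝ (Metric.closedBall (0 : E3) R) := convex_closedBall _ _
  have hlip : ∀ y ∈ Metric.closedBall (0 : E3) R,
      ‖velGrad T u (t, y) - velGrad T u (t, x)‖ ≤ K * ‖y - x‖ := by
    intro y hy
    refine hconv.norm_image_sub_le_of_norm_hasFDerivWithin_le
      (f := fun z => velGrad T u (t, z))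
      (fun z _ => (hasFDerivAt_space (hab ht) ?_).hasFDerivWithinAt)
      (fun z hz => (hK₂ (t, z) ⟨ht, hz⟩).trans ((le_max_right _ _).trans (le_max_left _ _))) hx hy
    exact ((ContinuousLinearMap.compL ℝ E3 (ℝ × E3) E3).flip
      (ContinuousLinearMap.inr ℝ ℝ E3)).hasFDerivAt.comp_hasFDerivWithinAt (t, z)
        (hu.hasFDerivWithinAt_spaceTimeDeriv ⟨hab ht, mem_univ _⟩)
  refine ⟨hK₁' x hx, fun y hy => ⟨?_, ?_⟩⟩
  · exact hconv.norm_image_sub_le_of_norm_hasFDerivWithin_le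
      (fun z _ => (hu.hasFDerivAt (hab ht) z).hasFDerivWithinAt) hK₁' hx hy
  -- On the part of the ball within distance `‖y - x‖` of `x` the gradient differs from its value at
  -- `x` by at most `K ‖y - x‖`; the mean value inequality there gives the quadratic remainder.
  · refine (hconv.inter (convex_closedBall x ‖y - x‖)).norm_image_sub_le_of_norm_hasFDerivWithin_le'
      (fun z _ => (hu.hasFDerivAt (hab ht) z).hasFDerivWithinAt) ?_ ⟨hx, by simp⟩
      ⟨hy, by simp [dist_eq_norm]⟩
    rintro z ⟨hz, hz'⟩
    refine (hlip z hz).trans ?_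
    rw [Metric.mem_closedBall, dist_eq_norm] at hz'
    gcongr

end IsEulerSolution

theorem HasDerivWithinAt.Ici_of_Ico {E : Type*} [NormedAddCommGroup E] [NormedSpace ℝ E]
    {f : ℝ → E} {f' : E} {a b t : ℝ} (h : HasDerivWithinAt f f' (Ico a b) t) (ht : t ∈ Ico a b) :
    HasDerivWithinAt f f' (Ici t) t :=
  h.mono_of_mem_nhdsWithin (mem_of_superset (Ico_mem_nhdsGE ht.2) (Ico_subset_Ico_left ht.1))

theorem HasDerivWithinAt.Iic_of_Ico {E : Type*} [NormedAddCommGroup E] [NormedSpace ℝ E]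
    {f : ℝ → E} {f' : E} {a b t : ℝ} (h : HasDerivWithinAt f f' (Ico a b) t) (ht : t ∈ Ioo a b) :
    HasDerivWithinAt f f' (Iic t) t :=
  h.mono_of_mem_nhdsWithin
    (mem_of_superset (Ioc_mem_nhdsLE ht.1) fun _ hs => ⟨hs.1.le, hs.2.trans_lt ht.2⟩)

namespace IsCarriedVortexLine

variable {T T₀ : ℝ} {u : ℝ → E3 → E3} {p : ℝ → E3 → ℝ} {I : Set ℝ} {Y : ℝ → ℝ → E3}

theorem continuousOn_time (hY : IsCarriedVortexLine u T₀ T I Y) {β : ℝ} (hβ : β ∈ I) :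
    ContinuousOn (Y β) (Ico T₀ T) := fun t ht => (hY.carried β hβ t ht).continuousWithinAt

/-- Particle paths with nearby labels stay close to each other. -/
theorem exists_lipschitz (hY : IsCarriedVortexLine u T₀ T I Y) (hu : IsEulerSolution T u p)
    (hT₀ : 0 ≤ T₀) {t₁ : ℝ} (ht₁ : t₁ ∈ Ico T₀ T) {β₀ : ℝ} (hβ₀ : β₀ ∈ I) :
    ∃ K > 0, ∃ δ > 0, ∀ β ∈ I, |β - β₀| < δ → ∀ t ∈ Icc T₀ t₁,
      ‖Y β t - Y β₀ t‖ ≤ K * |β - β₀| := by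
  have hsub : Icc T₀ t₁ ⊆ Ico T₀ T := fun s hs => ⟨hs.1, hs.2.trans_lt ht₁.2⟩
  have hsub' : Icc T₀ t₁ ⊆ Ico 0 T := fun s hs => ⟨hT₀.trans hs.1, hs.2.trans_lt ht₁.2⟩
  obtain ⟨R, hR⟩ := isCompact_Icc.exists_bound_of_continuousOn ((hY.continuousOn_time hβ₀).mono hsub)
  obtain ⟨K, hK0, hK⟩ := hu.exists_taylor_bound hsub' (R + 1)
  have hinit := (hasDerivWithinAt_iff_isLittleO.1 (hY.initial β₀ hβ₀)).bound one_pos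
  obtain ⟨δ, hδ, hinit⟩ := Metric.mem_nhdsWithin_iff.1 hinit
  set E := Real.exp ((K + 1) * (t₁ - T₀)) with hE
  have hE0 : 0 < E := Real.exp_pos _
  -- The factor `2` is the initial slope `|ξ| ≤ 1` plus an error of slope `1`. The radius `1 / (2
  -- E)` keeps the barrier below `1`, and the rate `K + 1` instead of `K` makes the barrier
  -- inequality strict.
  refine ⟨2 * E, by positivity, min δ (1 / (2 * E)), by positivity, fun β hβ hβδ => ?_⟩
  have hinitβ : ‖Y β T₀ - Y β₀ T₀‖ ≤ 2 * |β - β₀| := by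
    have h := hinit ⟨lt_of_lt_of_le hβδ (min_le_left _ _), hβ⟩
    simp only [mem_ofPred_eq, one_mul, Real.norm_eq_abs] at h
    have hξ : ‖xi u T₀ (Y β₀ T₀)‖ ≤ 1 := by
      rw [xi, norm_smul, norm_inv, norm_norm]
      exact inv_mul_le_one
    calc ‖Y β T₀ - Y β₀ T₀‖ ≤ ‖Y β T₀ - Y β₀ T₀ - (β - β₀) • xi u T₀ (Y β₀ T₀)‖
          + ‖(β - β₀) • xi u T₀ (Y β₀ T₀)‖ := norm_le_norm_sub_add _ _
      _ ≤ |β - β₀| + |β - β₀| * 1 := by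
          rw [norm_smul, Real.norm_eq_abs]
          gcongr
      _ = 2 * |β - β₀| := by ring
  rcases eq_or_ne β β₀ with rfl | hne
  · intro t _
    simp
  have hpos : 0 < |β - β₀| := abs_pos.2 (sub_ne_zero.2 hne)
  have hB : ∀ t ∈ Icc T₀ t₁, 2 * |β - β₀| * Real.exp ((K + 1) * (t - T₀)) ≤ 2 * E * |β - β₀| := by
    intro t ht
    have : Real.exp ((K + 1) * (t - T₀)) ≤ E := by
      apply Real.exp_le_exp.2
      have := ht.2
      gcongr
    calc _ ≤ 2 * |β - β₀| * E := by gcongr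
      _ = _ := by ring
  have hsmall : 2 * E * |β - β₀| ≤ 1 := by
    have := (hβδ.trans_le (min_le_right _ _)).le
    rwa [le_div_iff₀ (by positivity), mul_comm] at this
  intro t ht
  refine le_trans ?_ (hB t ht)
  refine image_norm_le_of_norm_deriv_right_lt_deriv_boundary (f := fun t => Y β t - Y β₀ t)
    (f' := fun t => u t (Y β t) - u t (Y β₀ t))
    (B := fun t => 2 * |β - β₀| * Real.exp ((K + 1) * (t - T₀)))
    (B' := fun t => 2 * |β - β₀| * (Real.exp ((K + 1) * (t - T₀)) * (K + 1)))
    (((hY.continuousOn_time hβ).sub (hY.continuousOn_time hβ₀)).mono hsub)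
    (fun s hs => ((hY.carried β hβ s (hsub ⟨hs.1, hs.2.le⟩)).Ici_of_Ico (hsub ⟨hs.1, hs.2.le⟩)).sub
      ((hY.carried β₀ hβ₀ s (hsub ⟨hs.1, hs.2.le⟩)).Ici_of_Ico (hsub ⟨hs.1, hs.2.le⟩)))
    (by simpa using hinitβ) ?_ ?_ ht
  · intro s
    have h := (((hasDerivAt_id s).sub_const T₀).const_mul (K + 1)).exp.const_mul (2 * |β - β₀|)
    simpa using h
  · intro s hs heq
    have hs' : s ∈ Icc T₀ t₁ := ⟨hs.1, hs.2.le⟩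
    -- The Lipschitz bound is only local, but it is needed only where the distance touches the
    -- barrier; there both points lie in the ball of radius `R + 1`.
    have h1 : ‖Y β s - Y β₀ s‖ ≤ 1 := heq.le.trans ((hB s hs').trans hsmall)
    have hm0 : Y β₀ s ∈ Metric.closedBall (0 : E3) (R + 1) := by
      rw [mem_closedBall_zero_iff]
      linarith [hR s hs']
    have hm : Y β s ∈ Metric.closedBall (0 : E3) (R + 1) := by
      rw [mem_closedBall_zero_iff]
      have := norm_add_le (Y β s - Y β₀ s) (Y β₀ s)
      rw [sub_add_cancel] at this
      linarith [hR s hs']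
    refine (((hK s hs' _ hm0).2 _ hm).1).trans_lt ?_
    rw [heq]
    have : 0 < 2 * |β - β₀| * Real.exp ((K + 1) * (s - T₀)) := by positivity
    nlinarith

theorem continuousOn_prod (hY : IsCarriedVortexLine u T₀ T I Y) (hu : IsEulerSolution T u p)
    (hT₀ : 0 ≤ T₀) : ContinuousOn (fun q : ℝ × ℝ => Y q.1 q.2) (I ×ˢ Ico T₀ T) := by
  rintro ⟨β₀, t₀⟩ ⟨hβ₀, ht₀⟩
  simp only at hβ₀ ht₀
  obtain ⟨t₁, ht₁, ht₁T⟩ := exists_between ht₀.2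
  obtain ⟨K, hK0, δ, hδ, hK⟩ := hY.exists_lipschitz hu hT₀ ⟨ht₀.1.trans ht₁.le, ht₁T⟩ hβ₀
  rw [ContinuousWithinAt, tendsto_iff_norm_sub_tendsto_zero]
  have hfst : Tendsto (fun q : ℝ × ℝ => q.1) (𝓝[I ×ˢ Ico T₀ T] (β₀, t₀)) (𝓝 β₀) :=
    (continuous_fst.tendsto (β₀, t₀)).mono_left nhdsWithin_le_nhds
  have hsnd : Tendsto (fun q : ℝ × ℝ => q.2) (𝓝[I ×ˢ Ico T₀ T] (β₀, t₀)) (𝓝 t₀) :=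
    (continuous_snd.tendsto (β₀, t₀)).mono_left nhdsWithin_le_nhds
  have h1 : Tendsto (fun q : ℝ × ℝ => K * |q.1 - β₀| + ‖Y β₀ q.2 - Y β₀ t₀‖)
      (𝓝[I ×ˢ Ico T₀ T] (β₀, t₀)) (𝓝 0) := by
    have ha : Tendsto (fun q : ℝ × ℝ => K * |q.1 - β₀|) (𝓝[I ×ˢ Ico T₀ T] (β₀, t₀)) (𝓝 0) := by
      simpa using (hfst.sub_const β₀).abs.const_mul K
    have hb : Tendsto (fun q : ℝ × ℝ => ‖Y β₀ q.2 - Y β₀ t₀‖)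
        (𝓝[I ×ˢ Ico T₀ T] (β₀, t₀)) (𝓝 0) := by
      refine tendsto_iff_norm_sub_tendsto_zero.1
        ((hY.continuousOn_time hβ₀ t₀ ht₀).tendsto.comp (tendsto_nhdsWithin_iff.2 ⟨hsnd, ?_⟩))
      filter_upwards [self_mem_nhdsWithin] with q hq using hq.2
    simpa using ha.add hb
  refine squeeze_zero' (Eventually.of_forall fun _ => norm_nonneg _) ?_ h1
  filter_upwards [self_mem_nhdsWithin, hfst.eventually (Metric.ball_mem_nhds _ hδ),
    hsnd.eventually (Iio_mem_nhds ht₁)] with q hq hq1 hq2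
  have h2 := hK q.1 hq.1 hq1 q.2 ⟨hq.2.1, le_of_lt hq2⟩
  have h3 := norm_add_le (Y q.1 q.2 - Y β₀ q.2) (Y β₀ q.2 - Y β₀ t₀)
  rw [sub_add_sub_cancel] at h3
  linarith

theorem hasDerivWithinAt_vorticity (hY : IsCarriedVortexLine u T₀ T I Y)
    (hu : IsEulerSolution T u p) (hT₀ : 0 ≤ T₀) {t : ℝ} (ht : t ∈ Ico T₀ T) {β : ℝ} (hβ : β ∈ I) :
    HasDerivWithinAt (fun t => vorticity u t (Y β t))
      (velGrad T u (t, Y β t) (vorticity u t (Y β t))) (Ico T₀ T) t :=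
  hu.hasDerivWithinAt_vorticity ⟨hT₀.trans ht.1, ht.2⟩ (Ico_subset_Ico_left hT₀)
    (hY.carried β hβ t ht)

/-- A line that is a vortex line initially and is carried by the flow remains a vortex line. -/
theorem hasDerivWithinAt_label (hY : IsCarriedVortexLine u T₀ T I Y) (hu : IsEulerSolution T u p)
    (hT₀ : 0 ≤ T₀) {t : ℝ} (ht : t ∈ Ico T₀ T) {β₀ : ℝ} (hβ₀ : β₀ ∈ I) :
    HasDerivWithinAt (fun β => Y β t)
      (‖vorticity u T₀ (Y β₀ T₀)‖⁻¹ • vorticity u t (Y β₀ t)) I β₀ := by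
  have hsub : Icc T₀ t ⊆ Ico T₀ T := fun s hs => ⟨hs.1, hs.2.trans_lt ht.2⟩
  have hsub' : Icc T₀ t ⊆ Ico 0 T := fun s hs => ⟨hT₀.trans hs.1, hs.2.trans_lt ht.2⟩
  obtain ⟨L, hL0, δ, hδ, hL⟩ := hY.exists_lipschitz hu hT₀ ht hβ₀
  obtain ⟨R, hR⟩ := isCompact_Icc.exists_bound_of_continuousOn ((hY.continuousOn_time hβ₀).mono hsub)
  obtain ⟨K, hK0, hK⟩ := hu.exists_taylor_bound hsub' (R + 1)
  -- By the vorticity equation `w` solves the flow linearized along the path of `β₀`, starting from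
  -- `ξ`, just as the label derivative of `Y` should.
  set w : ℝ → E3 := fun s => ‖vorticity u T₀ (Y β₀ T₀)‖⁻¹ • vorticity u s (Y β₀ s)
  have hwd : ∀ s ∈ Ico T₀ T, HasDerivWithinAt w (velGrad T u (s, Y β₀ s) (w s)) (Ico T₀ T) s := by
    intro s hs
    have := (hY.hasDerivWithinAt_vorticity hu hT₀ hs hβ₀).const_smul
      (‖vorticity u T₀ (Y β₀ T₀)‖⁻¹)
    rwa [← map_smul] at this
  have hwT : w T₀ = xi u T₀ (Y β₀ T₀) := rfl
  rw [hasDerivWithinAt_iff_isLittleO, Asymptotics.isLittleO_iff]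
  intro c hc
  set E := Real.exp (K * (t - T₀)) with hE
  have hE0 : 0 < E := Real.exp_pos _
  have hinit := (hasDerivWithinAt_iff_isLittleO.1 (hY.initial β₀ hβ₀)).bound
    (show 0 < c / (2 * E) by positivity)
  -- The bound `1 / L` keeps the neighbouring path in the ball of radius `R + 1`. The last bound
  -- makes the quadratic remainder contribute at most half of `c |β - β₀|` after Grönwall; the
  -- initial error contributes the other half.
  have hnear : ∀ᶠ β in 𝓝[I] β₀, |β - β₀| < min δ (min (1 / L) (c / (2 * E * L ^ 2))) :=
    mem_nhdsWithin_of_mem_nhds (Metric.ball_mem_nhds β₀ (by positivity))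
  filter_upwards [hinit, hnear, self_mem_nhdsWithin] with β hβi hβn hβ
  have hLβ := hL β hβ (hβn.trans_le (min_le_left _ _))
  have hβ1 : L * |β - β₀| ≤ 1 := by
    have := (hβn.trans_le ((min_le_right _ _).trans (min_le_left _ _))).le
    rwa [le_div_iff₀ hL0, mul_comm] at this
  have hβ2 : L ^ 2 * |β - β₀| ≤ c / (2 * E) := by
    have := (hβn.trans_le ((min_le_right _ _).trans (min_le_right _ _))).le
    rw [le_div_iff₀ (by positivity)] at this
    rw [le_div_iff₀ (by positivity)]
    linarith
  have hg := norm_le_gronwallBound_of_norm_deriv_right_le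
    (f := fun s => Y β s - Y β₀ s - (β - β₀) • w s)
    (f' := fun s => u s (Y β s) - u s (Y β₀ s) - (β - β₀) • velGrad T u (s, Y β₀ s) (w s))
    (δ := c / (2 * E) * |β - β₀|) (K := K) (ε := K * (L * |β - β₀|) * (L * |β - β₀|))
    (a := T₀) (b := t) ?_ ?_ ?_ ?_ t ⟨ht.1, le_rfl⟩
  · rw [gronwallBound_of_K_ne_0 hK0.ne'] at hg
    refine hg.trans ?_
    rw [Real.norm_eq_abs]
    have e1 : K * (L * |β - β₀|) * (L * |β - β₀|) / K = L ^ 2 * |β - β₀| * |β - β₀| := by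
      field_simp
    rw [e1]
    beta_reduce
    rw [← hE]
    have h0 := abs_nonneg (β - β₀)
    calc c / (2 * E) * |β - β₀| * E + L ^ 2 * |β - β₀| * |β - β₀| * (E - 1)
        ≤ c / (2 * E) * |β - β₀| * E + c / (2 * E) * |β - β₀| * E := by
          have : L ^ 2 * |β - β₀| * |β - β₀| * (E - 1) ≤ L ^ 2 * |β - β₀| * |β - β₀| * E := by
            gcongr; linarith
          refine add_le_add_right (this.trans ?_) _
          gcongr
      _ = c * |β - β₀| := by field_simp; ring
  · have hwc : ContinuousOn w (Ico T₀ T) := fun s hs => (hwd s hs).continuousWithinAt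
    exact (((hY.continuousOn_time hβ).sub (hY.continuousOn_time hβ₀)).sub
      (hwc.const_smul (β - β₀))).mono hsub
  · intro s hs
    have hs' := hsub ⟨hs.1, hs.2.le⟩
    exact (((hY.carried β hβ s hs').sub (hY.carried β₀ hβ₀ s hs')).sub
      ((hwd s hs').const_smul (β - β₀))).Ici_of_Ico hs'
  · simpa [hwT] using hβi
  · intro s hs
    have hs' : s ∈ Icc T₀ t := ⟨hs.1, hs.2.le⟩
    have hYs := hLβ s hs'
    have hm0 : Y β₀ s ∈ Metric.closedBall (0 : E3) (R + 1) := by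
      rw [mem_closedBall_zero_iff]
      linarith [hR s hs']
    have hm : Y β s ∈ Metric.closedBall (0 : E3) (R + 1) := by
      rw [mem_closedBall_zero_iff]
      have := norm_add_le (Y β s - Y β₀ s) (Y β₀ s)
      rw [sub_add_cancel] at this
      linarith [hR s hs']
    obtain ⟨hA, hA'⟩ := hK s hs' _ hm0
    have hq := (hA' _ hm).2
    set A := velGrad T u (s, Y β₀ s)
    have e : u s (Y β s) - u s (Y β₀ s) - (β - β₀) • A (w s)
        = A (Y β s - Y β₀ s - (β - β₀) • w s)
          + (u s (Y β s) - u s (Y β₀ s) - A (Y β s - Y β₀ s)) := by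
      simp only [map_sub, map_smul]; abel
    rw [e]
    refine (norm_add_le _ _).trans (add_le_add ?_ (hq.trans ?_))
    · exact A.le_of_opNorm_le hA _
    · gcongr

/-- The vorticity does not vanish along the carried vortex line. -/
theorem vorticity_ne_zero (hY : IsCarriedVortexLine u T₀ T I Y) (hu : IsEulerSolution T u p)
    (hT₀ : 0 ≤ T₀) {t : ℝ} (ht : t ∈ Ico T₀ T) {β : ℝ} (hβ : β ∈ I) :
    vorticity u t (Y β t) ≠ 0 := by
  intro h0
  have hsub : Icc T₀ t ⊆ Ico T₀ T := fun s hs => ⟨hs.1, hs.2.trans_lt ht.2⟩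
  have hA : ContinuousOn (fun s => velGrad T u (s, Y β s)) (Icc T₀ t) :=
    hu.continuousOn_velGrad.comp (continuousOn_id.prodMk ((hY.continuousOn_time hβ).mono hsub))
      fun s hs => ⟨⟨hT₀.trans hs.1, (hsub hs).2⟩, mem_univ _⟩
  obtain ⟨K, hK⟩ := isCompact_Icc.exists_bound_of_continuousOn hA
  -- Along the path the vorticity solves a linear equation; if it vanished at `t`, uniqueness
  -- backward in time would make it vanish at `T₀`.
  have h := ODE_solution_unique_of_mem_Icc_left (a := T₀) (b := t) (K := K.toNNReal)
    (v := fun s x => velGrad T u (s, Y β s) x) (s := fun _ => univ)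
    (f := fun s => vorticity u s (Y β s)) (g := fun _ => 0)
    (fun s hs => ?_)
    (fun s hs => ((hY.hasDerivWithinAt_vorticity hu hT₀ (hsub hs) hβ).mono hsub).continuousWithinAt)
    (fun s hs => (hY.hasDerivWithinAt_vorticity hu hT₀ (hsub ⟨hs.1.le, hs.2⟩) hβ).Iic_of_Ico
      ⟨hs.1, hs.2.trans_lt ht.2⟩)
    (fun _ _ => mem_univ _) continuousOn_const
    (fun s _ => by simpa using hasDerivWithinAt_const s (Iic s) (0 : E3)) (fun _ _ => mem_univ _) h0
  · exact hY.initial_ne_zero β hβ (h ⟨le_rfl, ht.1⟩)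
  · refine LipschitzWith.lipschitzOnWith ?_
    refine (velGrad T u (s, Y β s)).lipschitz.weaken ?_
    rw [← NNReal.coe_le_coe, coe_nnnorm]
    exact (hK s ⟨hs.1.le, hs.2⟩).trans (Real.le_coe_toNNReal K)

end IsCarriedVortexLine

/-! ### Leibniz rules with moving limits. -/

/-- The Leibniz rule for integrals with a variable upper limit, on compact intervals. -/
theorem hasDerivWithinAt_integral_of_continuousOn {F F' : ℝ → ℝ → ℝ} {A B a b t c' : ℝ} {c : ℝ → ℝ}
    (hF : ContinuousOn (fun q : ℝ × ℝ => F q.1 q.2) (Icc A B ×ˢ Icc a b))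
    (hF' : ContinuousOn (fun q : ℝ × ℝ => F' q.1 q.2) (Icc A B ×ˢ Icc a b))
    (hd : ∀ β ∈ Icc A B, ∀ t ∈ Icc a b, HasDerivWithinAt (F β) (F' β t) (Icc a b) t)
    (ht : t ∈ Icc a b) (hcm : ∀ s ∈ Icc a b, c s ∈ Icc A B)
    (hc : HasDerivWithinAt c c' (Icc a b) t) :
    HasDerivWithinAt (fun s => ∫ β in A..c s, F β s)
      ((∫ β in A..c t, F' β t) + F (c t) t * c') (Icc a b) t := by
  have hAB : A ≤ B := (hcm t ht).1.trans (hcm t ht).2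
  have hFs : ∀ s ∈ Icc a b, ContinuousOn (fun β => F β s) (Icc A B) := fun s hs =>
    hF.comp (continuousOn_id.prodMk continuousOn_const) fun β hβ => ⟨hβ, hs⟩
  have hFs' : ∀ s ∈ Icc a b, ContinuousOn (fun β => F' β s) (Icc A B) := fun s hs =>
    hF'.comp (continuousOn_id.prodMk continuousOn_const) fun β hβ => ⟨hβ, hs⟩
  have hint : ∀ {f : ℝ → ℝ}, ContinuousOn f (Icc A B) → ∀ {x y}, x ∈ Icc A B → y ∈ Icc A B →
      IntervalIntegrable f volume x y := fun hf _ _ hx hy =>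
    (hf.mono (ordConnected_Icc.uIcc_subset hx hy)).intervalIntegrable
  have hA : A ∈ Icc A B := ⟨le_rfl, hAB⟩
  -- Fixed range: uniform continuity of `F'` and the mean value inequality make the Taylor error
  -- uniform in `β`.
  have h1 : (fun s => ∫ β in A..c t, (F β s - F β t - (s - t) * F' β t))
      =o[𝓝[Icc a b] t] fun s => s - t := by
    rw [isLittleO_iff]
    intro ε hε
    have huc := (isCompact_Icc.prod isCompact_Icc).uniformContinuousOn_of_continuous hF'
    rw [Metric.uniformContinuousOn_iff] at huc
    obtain ⟨δ, hδ, hδ'⟩ := huc (ε / (B - A + 1)) (div_pos hε (by linarith))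
    filter_upwards [self_mem_nhdsWithin, mem_nhdsWithin_of_mem_nhds (Metric.ball_mem_nhds t hδ)]
      with s hs hst
    have hb : ∀ β ∈ Icc A B, ‖F β s - F β t - (s - t) * F' β t‖ ≤ ε / (B - A + 1) * ‖s - t‖ := by
      intro β hβ
      have hconv : Convex ℝ (Icc a b ∩ Metric.ball t δ) :=
        (convex_Icc a b).inter (convex_ball t δ)
      have := hconv.norm_image_sub_le_of_norm_hasDerivWithin_le
        (f := fun r => F β r - r * F' β t) (f' := fun r => F' β r - 1 * F' β t)
        (C := ε / (B - A + 1)) (x := t) (y := s) (fun r hr =>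
          ((hd β hβ r hr.1).mono inter_subset_left).sub
            ((hasDerivWithinAt_id r _).mul_const _)) ?_ ⟨ht, Metric.mem_ball_self hδ⟩ ⟨hs, hst⟩
      · refine (le_of_eq (congrArg _ ?_)).trans this
        ring
      · intro r hr
        rw [one_mul, ← dist_eq_norm]
        refine (hδ' (β, r) ⟨hβ, hr.1⟩ (β, t) ⟨hβ, ht⟩ ?_).le
        rw [Prod.dist_eq, dist_self]
        exact max_lt hδ hr.2
    refine (intervalIntegral.norm_integral_le_of_norm_le_const (C := ε / (B - A + 1) * ‖s - t‖)
      fun β hβ => hb β ?_).trans ?_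
    · rw [uIoc_of_le (hcm t ht).1] at hβ
      exact ⟨hβ.1.le, hβ.2.trans (hcm t ht).2⟩
    · rw [abs_of_nonneg (sub_nonneg.2 (hcm t ht).1)]
      have h2 : c t - A ≤ B - A + 1 := by linarith [(hcm t ht).2]
      have h3 : 0 < B - A + 1 := by linarith
      calc _ ≤ ε / (B - A + 1) * ‖s - t‖ * (B - A + 1) := by gcongr
        _ = ε * ‖s - t‖ := by field_simp
  -- Boundary layer: freezing the integrand at `(c t, t)` costs `o(c s - c t)`, and `c s - c t = O(s
  -- - t)`.
  have h2 : (fun s => ∫ β in c t..c s, (F β s - F (c t) t)) =o[𝓝[Icc a b] t] fun s => s - t := by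
    have hO : (fun s => c s - c t) =O[𝓝[Icc a b] t] fun s => s - t :=
      hc.differentiableWithinAt.isBigO_sub
    refine IsLittleO.trans_isBigO ?_ hO
    rw [isLittleO_iff]
    intro ε hε
    have hcont := hF (c t, t) ⟨hcm t ht, ht⟩
    rw [Metric.continuousWithinAt_iff] at hcont
    obtain ⟨δ, hδ, hδ'⟩ := hcont ε hε
    filter_upwards [self_mem_nhdsWithin, mem_nhdsWithin_of_mem_nhds (Metric.ball_mem_nhds t hδ),
      hc.continuousWithinAt.eventually (Metric.ball_mem_nhds _ hδ)] with s hs hst hcs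
    refine intervalIntegral.norm_integral_le_of_norm_le_const fun β hβ => ?_
    have hβ' := uIoc_subset_uIcc hβ
    rw [← dist_eq_norm]
    refine (hδ' (x := (β, s)) ⟨ordConnected_Icc.uIcc_subset (hcm t ht) (hcm s hs) hβ', hs⟩ ?_).le
    rw [Prod.dist_eq]
    refine max_lt ?_ hst
    have := abs_sub_left_of_mem_uIcc hβ'
    exact lt_of_le_of_lt this hcs
  have h3 : (fun s => F (c t) t * (c s - c t - (s - t) * c')) =o[𝓝[Icc a b] t] fun s => s - t :=
    (hasDerivWithinAt_iff_isLittleO.1 hc).const_mul_left _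
  rw [hasDerivWithinAt_iff_isLittleO]
  refine ((h1.add h2).add h3).congr' ?_ EventuallyEq.rfl
  filter_upwards [self_mem_nhdsWithin] with s hs
  have i1 := hint (hFs s hs) hA (hcm t ht)
  have i2 := hint (hFs t ht) hA (hcm t ht)
  have i3 := hint (hFs' t ht) hA (hcm t ht)
  have i4 := hint (hFs s hs) (hcm t ht) (hcm s hs)
  rw [intervalIntegral.integral_sub (i1.sub i2) (i3.const_mul _), intervalIntegral.integral_sub i1 i2,
    intervalIntegral.integral_sub i4 intervalIntegrable_const,
    ← intervalIntegral.integral_add_adjacent_intervals i1 i4, intervalIntegral.integral_const_mul,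
    intervalIntegral.integral_const]
  simp only [smul_eq_mul]
  ring

/-- The Leibniz rule for integrals with two variable limits, on compact intervals. -/
theorem hasDerivWithinAt_integral_of_continuousOn₂ {F F' : ℝ → ℝ → ℝ} {A B a b t c' d' : ℝ}
    {c d : ℝ → ℝ}
    (hF : ContinuousOn (fun q : ℝ × ℝ => F q.1 q.2) (Icc A B ×ˢ Icc a b))
    (hF' : ContinuousOn (fun q : ℝ × ℝ => F' q.1 q.2) (Icc A B ×ˢ Icc a b))
    (hd : ∀ β ∈ Icc A B, ∀ t ∈ Icc a b, HasDerivWithinAt (F β) (F' β t) (Icc a b) t)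
    (ht : t ∈ Icc a b) (hcm : ∀ s ∈ Icc a b, c s ∈ Icc A B) (hdm : ∀ s ∈ Icc a b, d s ∈ Icc A B)
    (hc : HasDerivWithinAt c c' (Icc a b) t) (hd' : HasDerivWithinAt d d' (Icc a b) t) :
    HasDerivWithinAt (fun s => ∫ β in c s..d s, F β s)
      ((∫ β in c t..d t, F' β t) + F (d t) t * d' - F (c t) t * c') (Icc a b) t := by
  have hAB : A ≤ B := (hcm t ht).1.trans (hcm t ht).2
  have hA : A ∈ Icc A B := ⟨le_rfl, hAB⟩
  have hint : ∀ {G : ℝ → ℝ → ℝ}, ContinuousOn (fun q : ℝ × ℝ => G q.1 q.2) (Icc A B ×ˢ Icc a b) →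
      ∀ s ∈ Icc a b, ∀ y ∈ Icc A B, IntervalIntegrable (fun β => G β s) volume A y :=
    fun {G} hG s hs y hy => by
      refine ContinuousOn.intervalIntegrable ?_
      exact hG.comp (f := fun β : ℝ => (β, s)) (continuousOn_id.prodMk continuousOn_const)
        fun β hβ => ⟨ordConnected_Icc.uIcc_subset hA hy hβ, hs⟩
  have h := (hasDerivWithinAt_integral_of_continuousOn hF hF' hd ht hdm hd').sub
    (hasDerivWithinAt_integral_of_continuousOn hF hF' hd ht hcm hc)
  have e : ∀ {G : ℝ → ℝ → ℝ}, ContinuousOn (fun q : ℝ × ℝ => G q.1 q.2) (Icc A B ×ˢ Icc a b) →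
      ∀ s ∈ Icc a b, ∫ β in c s..d s, G β s = (∫ β in A..d s, G β s) - ∫ β in A..c s, G β s :=
    fun hG s hs => (intervalIntegral.integral_interval_sub_left (hint hG s hs _ (hdm s hs))
      (hint hG s hs _ (hcm s hs))).symm
  refine (h.congr (fun s hs => e hF s hs) (e hF t ht)).congr_deriv ?_
  rw [e hF' t ht]
  ring

/-! ### The one-dimensional stretching estimate. -/

theorem two_le_add_four_mul_exp_neg (a : ℝ) : 2 ≤ a + 4 * Real.exp (-a) := by
  have h := Real.add_one_le_exp (Real.log 4 - a)
  have e : Real.exp (Real.log 4 - a) = 4 * Real.exp (-a) := by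
    rw [sub_eq_add_neg, Real.exp_add, Real.exp_log (by norm_num)]
  have h4 : 1 ≤ Real.log 4 := by
    have : Real.log 4 = 2 * Real.log 2 := by
      rw [show (4 : ℝ) = 2 ^ 2 by norm_num, Real.log_pow]; norm_num
    linarith [Real.log_two_gt_d9]
  linarith

/-- The left side collects the terms of the integration by parts in units of `U M`, with `exp (-a)`
the ratio of the end values of `g`. If `2 exp (-a) < 1`, the inequality reduces to `2 ≤ a + 4 exp
(-a) + c (c - a)`; otherwise to `0 ≤ a + c (c - a)`. -/
theorem one_add_abs_two_mul_exp_le {a c : ℝ} (ha : 0 ≤ a) (hac : a ≤ c) :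
    1 + |2 * Real.exp (-a) - 1| + 2 * (1 - Real.exp (-a) + (c - a)) + c
      ≤ (2 * c + 2) * (1 + (c - a) / 2) := by
  have h := two_le_add_four_mul_exp_neg a
  have hc : 0 ≤ c := ha.trans hac
  have h1 : 0 ≤ c * (c - a) := mul_nonneg hc (sub_nonneg.2 hac)
  rcases abs_cases (2 * Real.exp (-a) - 1) with ⟨h2, _⟩ | ⟨h2, _⟩ <;> rw [h2] <;> nlinarith

/-- The growth rate of the mean of `g` on a segment whose end point carries the maximum of `g`, and
the comparison of the maximum with the mean. -/
theorem integral_stretching_le {l C₀ Cl U σ : ℝ} {g τ A α k κ : ℝ → ℝ} (hl : 0 < l)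
    (hg0 : ∀ s ∈ Icc 0 l, 0 < g s) (hgl : ∀ s ∈ Icc 0 l, g s ≤ g l)
    (hg : ∀ s ∈ Icc 0 l, HasDerivWithinAt g (-(τ s * g s)) (Icc 0 l) s)
    (hτc : ContinuousOn τ (Icc 0 l)) (hτ : ∫ s in (0 : ℝ)..l, |τ s| ≤ C₀)
    (hA : ∀ s ∈ Icc 0 l, HasDerivWithinAt A (α s + k s) (Icc 0 l) s)
    (hαc : ContinuousOn α (Icc 0 l)) (hkc : ContinuousOn k (Icc 0 l))
    (hAU : ∀ s ∈ Icc 0 l, |A s| ≤ U) (hk : ∀ s ∈ Icc 0 l, |k s| ≤ U * κ s)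
    (hκc : ContinuousOn κ (Icc 0 l)) (hκ : ∫ s in (0 : ℝ)..l, κ s ≤ C₀) (hCl : 0 ≤ Cl)
    (hσ : |σ| ≤ (Cl + 1) * U) :
    (∫ s in (0 : ℝ)..l, α s * (2 * g s - g l)) + σ * (g l - g 0)
      ≤ constCV C₀ Cl * U * (1 / l * ∫ s in (0 : ℝ)..l, g s) ∧
    g l ≤ Real.exp C₀ * (1 / l * ∫ s in (0 : ℝ)..l, g s) := by
  have h0 : (0 : ℝ) ∈ Icc 0 l := ⟨le_rfl, hl.le⟩
  have hll : l ∈ Icc 0 l := ⟨hl.le, le_rfl⟩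
  have hM := hg0 l hll
  have hU : 0 ≤ U := (abs_nonneg _).trans (hAU 0 h0)
  have hgc : ContinuousOn g (Icc 0 l) := fun s hs => (hg s hs).continuousWithinAt
  have hAc : ContinuousOn A (Icc 0 l) := fun s hs => (hA s hs).continuousWithinAt
  have hint : ∀ {f : ℝ → ℝ}, ContinuousOn f (Icc 0 l) → ∀ {x y}, x ∈ Icc 0 l → y ∈ Icc 0 l →
      IntervalIntegrable f volume x y := fun hf _ _ hx hy =>
    (hf.mono (ordConnected_Icc.uIcc_subset hx hy)).intervalIntegrable
  have hftc : ∀ {f f' : ℝ → ℝ}, (∀ s ∈ Icc 0 l, HasDerivWithinAt f (f' s) (Icc 0 l) s) →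
      ContinuousOn f' (Icc 0 l) → ∀ {x y}, x ∈ Icc 0 l → y ∈ Icc 0 l → x ≤ y →
      ∫ s in x..y, f' s = f y - f x := by
    intro f f' hf hf' x y hx hy hxy
    refine intervalIntegral.integral_eq_sub_of_hasDerivAt_of_le hxy
      (fun s hs => ((hf s ⟨hx.1.trans hs.1, hs.2.trans hy.2⟩).mono
        (Icc_subset_Icc hx.1 hy.2)).continuousWithinAt)
      (fun s hs => (hf s ⟨hx.1.trans hs.1.le, hs.2.le.trans hy.2⟩).hasDerivAt
        (Icc_mem_nhds (hx.1.trans_lt hs.1) (hs.2.trans_le hy.2))) (hint hf' hx hy)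
  have hmono : ∀ {f h : ℝ → ℝ}, ContinuousOn f (Icc 0 l) → ContinuousOn h (Icc 0 l) →
      (∀ s ∈ Icc 0 l, f s ≤ h s) → ∫ s in (0 : ℝ)..l, f s ≤ ∫ s in (0 : ℝ)..l, h s :=
    fun hf hh hfh => intervalIntegral.integral_mono_on hl.le (hint hf h0 hll) (hint hh h0 hll) hfh
  set M := g l with hMdef
  set γ := g 0 / M with hγ
  set a := -Real.log γ with ha
  have hg00 := hg0 0 h0
  have hγ0 : 0 < γ := div_pos hg00 hM
  have hγ1 : γ ≤ 1 := (div_le_one hM).2 (hgl 0 h0)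
  have hea : Real.exp (-a) = γ := by rw [ha, neg_neg, Real.exp_log hγ0]
  have hg0γ : g 0 = M * γ := by rw [hγ]; field_simp
  have hlog0 : Real.log (g 0) = Real.log M - a := by
    rw [hg0γ, Real.log_mul hM.ne' hγ0.ne']; ring
  -- the logarithm of `g`
  have hφ : ∀ s ∈ Icc 0 l, HasDerivWithinAt (fun s => -Real.log (g s)) (τ s) (Icc 0 l) s := by
    intro s hs
    have := ((hg s hs).log (hg0 s hs).ne').neg
    refine this.congr_deriv ?_
    have := (hg0 s hs).ne'
    field_simp
  have hτa := hτc.abs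
  have hτI : ∫ s in (0 : ℝ)..l, τ s = -a := by
    rw [hftc hφ hτc h0 hll hl.le, hlog0]; ring
  have ha0 : 0 ≤ a := neg_nonneg.2 (Real.log_nonpos hγ0.le hγ1)
  have haC : a ≤ C₀ := by
    have := hmono hτc.neg hτa (fun s _ => neg_le_abs (τ s))
    simp only [Pi.neg_apply, intervalIntegral.integral_neg] at this
    linarith
  have hC₀ : 0 ≤ C₀ := ha0.trans haC
  -- lower bounds
  have hlow : ∀ s ∈ Icc 0 l, M * Real.exp (-((C₀ + a) / 2)) ≤ g s := by
    intro s hs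
    -- Both end points bound `log (g s)` from below. Averaging the two bounds makes the integrals of
    -- `|τ|` over `[0, s]` and `[s, l]` share the single budget `C₀`, hence the exponent `(C₀ + a) /
    -- 2`.
    have e1 := hftc hφ hτc h0 hs hs.1
    have e2 := hftc hφ hτc hs hll hs.2
    have e3 := intervalIntegral.integral_add_adjacent_intervals (hint hτa h0 hs) (hint hτa hs hll)
    have b1 : ∫ r in (0 : ℝ)..s, τ r ≤ ∫ r in (0 : ℝ)..s, |τ r| :=
      intervalIntegral.integral_mono_on hs.1 (hint hτc h0 hs) (hint hτa h0 hs)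
        fun r _ => le_abs_self _
    have b2 : -∫ r in s..l, τ r ≤ ∫ r in s..l, |τ r| := by
      rw [← intervalIntegral.integral_neg]
      exact intervalIntegral.integral_mono_on hs.2 (hint hτc.neg hs hll) (hint hτa hs hll)
        fun r _ => neg_le_abs _
    rw [hlog0] at e1
    rw [← Real.exp_log (hg0 s hs), ← Real.exp_log hM, ← Real.exp_add]
    apply Real.exp_le_exp.2
    linarith
  set q := 1 / l * ∫ s in (0 : ℝ)..l, g s with hq
  have hqlow : M * Real.exp (-((C₀ + a) / 2)) ≤ q := by
    have := hmono continuousOn_const hgc hlow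
    rw [intervalIntegral.integral_const, smul_eq_mul, sub_zero] at this
    rw [hq, one_div, ← div_eq_inv_mul, le_div_iff₀ hl]
    linarith
  have hE : 0 < Real.exp C₀ := Real.exp_pos _
  have hqC : M * (1 + (C₀ - a) / 2) ≤ Real.exp C₀ * q := by
    calc M * (1 + (C₀ - a) / 2) ≤ M * Real.exp ((C₀ - a) / 2) := by
          gcongr
          linarith [Real.add_one_le_exp ((C₀ - a) / 2)]
      _ = Real.exp C₀ * (M * Real.exp (-((C₀ + a) / 2))) := by
          rw [mul_left_comm, ← Real.exp_add]
          ring_nf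
      _ ≤ _ := by gcongr
  have hq2 : M * (1 - γ) ≤ (Real.exp C₀ - 1) * q := by
    have h1 : M * Real.exp (-C₀) ≤ q := by
      refine le_trans ?_ hqlow
      gcongr
      linarith
    have h2 : Real.exp (-C₀) ≤ γ := by
      rw [← hea]
      exact Real.exp_le_exp.2 (by linarith)
    have h3 : 1 ≤ Real.exp C₀ := Real.one_le_exp hC₀
    calc M * (1 - γ) ≤ M * (1 - Real.exp (-C₀)) := by gcongr
      _ = (Real.exp C₀ - 1) * (M * Real.exp (-C₀)) := by
          rw [Real.exp_neg]; field_simp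
      _ ≤ _ := by
          gcongr
  -- total variation of `g`
  have c1 : ContinuousOn (fun s => -(τ s * g s)) (Icc 0 l) := (hτc.mul hgc).neg
  have c2 : ContinuousOn (fun s => |τ s| + τ s) (Icc 0 l) := hτa.add hτc
  have c3 : ContinuousOn (fun s => (|τ s| + τ s) * M) (Icc 0 l) := c2.mul continuousOn_const
  have c4 : ContinuousOn (fun s => |τ s| * g s) (Icc 0 l) := hτa.mul hgc
  have hTV : ∫ s in (0 : ℝ)..l, |τ s| * g s ≤ M * (1 - γ + (C₀ - a)) := by
    -- Write `|τ| g = (|τ| + τ) g - τ g`: in the first term `g ≤ M`, and the second is `g'`, which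
    -- integrates exactly. Since `∫ τ = -a`, this gains the saving `C₀ - a`.
    have h1 : ∫ s in (0 : ℝ)..l, |τ s| * g s
        ≤ ∫ s in (0 : ℝ)..l, ((|τ s| + τ s) * M + -(τ s * g s)) := by
      refine hmono c4 (c3.add c1) ?_
      intro s hs
      have := mul_le_mul_of_nonneg_left (hgl s hs) (show 0 ≤ |τ s| + τ s by
        linarith [neg_le_abs (τ s)])
      linarith
    have e := hftc hg c1 h0 hll hl.le
    rw [intervalIntegral.integral_add (hint c3 h0 hll) (hint c1 h0 hll), e, intervalIntegral.integral_mul_const,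
      intervalIntegral.integral_add (hint hτa h0 hll) (hint hτc h0 hll), hτI, hg0γ] at h1
    have : (∫ s in (0 : ℝ)..l, |τ s|) * M ≤ C₀ * M := by gcongr
    linarith
  -- integration by parts
  have hP : ∀ s ∈ Icc 0 l, HasDerivWithinAt (fun s => A s * (2 * g s - M))
      ((α s + k s) * (2 * g s - M) + A s * (2 * -(τ s * g s))) (Icc 0 l) s := fun s hs =>
    (hA s hs).mul (((hg s hs).const_mul 2).sub_const M)
  have hgM : ContinuousOn (fun s => 2 * g s - M) (Icc 0 l) :=
    (continuousOn_const.mul hgc).sub continuousOn_const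
  have c5 : ContinuousOn (fun s => (α s + k s) * (2 * g s - M) + A s * (2 * -(τ s * g s)))
      (Icc 0 l) := ((hαc.add hkc).mul hgM).add (hAc.mul (continuousOn_const.mul c1))
  have c6 : ContinuousOn (fun s => U * M * κ s) (Icc 0 l) := continuousOn_const.mul hκc
  have c7 : ContinuousOn (fun s => 2 * U * (|τ s| * g s)) (Icc 0 l) := continuousOn_const.mul c4
  have c8 : ContinuousOn (fun s => U * M * κ s + 2 * U * (|τ s| * g s)) (Icc 0 l) := c6.add c7
  have hP' := hftc hP c5 h0 hll hl.le
  -- The integrand equals the derivative of `A (2 g - M)` minus `k (2 g - M)` plus `2 A τ g`; the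
  -- weight satisfies `|2 g - M| ≤ M`.
  have hα : ∫ s in (0 : ℝ)..l, α s * (2 * g s - M) ≤
      ∫ s in (0 : ℝ)..l, (((α s + k s) * (2 * g s - M) + A s * (2 * -(τ s * g s)))
        + (U * M * κ s + 2 * U * (|τ s| * g s))) := by
    refine hmono (hαc.mul hgM) (c5.add c8) ?_
    intro s hs
    have hgs := hg0 s hs
    have hgs' := hgl s hs
    have hx : -(k s * (2 * g s - M)) ≤ U * M * κ s := by
      refine (neg_le_abs _).trans ?_
      rw [abs_mul]
      have h1 : |2 * g s - M| ≤ M := abs_le.2 ⟨by linarith, by linarith⟩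
      calc |k s| * |2 * g s - M| ≤ (U * κ s) * M := by
            gcongr
            · exact (abs_nonneg _).trans (hk s hs)
            · exact hk s hs
        _ = _ := by ring
    have hy : A s * τ s * g s ≤ U * |τ s| * g s := by
      refine mul_le_mul_of_nonneg_right ((le_abs_self _).trans ?_) hgs.le
      rw [abs_mul]
      exact mul_le_mul_of_nonneg_right (hAU s hs) (abs_nonneg _)
    linarith
  rw [intervalIntegral.integral_add (hint c5 h0 hll) (hint c8 h0 hll), hP',
    intervalIntegral.integral_add (hint c6 h0 hll) (hint c7 h0 hll),
    intervalIntegral.integral_const_mul, intervalIntegral.integral_const_mul, hg0γ] at hα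
  have b1 : A l * (2 * M - M) ≤ U * M := by
    have := (le_abs_self _).trans (hAU l hll)
    have e : 2 * M - M = M := by ring
    rw [e]
    gcongr
  have b2 : -(A 0 * (2 * (M * γ) - M)) ≤ U * M * |2 * γ - 1| := by
    refine (neg_le_abs _).trans ?_
    rw [abs_mul, show 2 * (M * γ) - M = M * (2 * γ - 1) by ring, abs_mul, abs_of_pos hM, ← mul_assoc]
    gcongr
    exact hAU 0 h0
  have b3 : U * M * ∫ s in (0 : ℝ)..l, κ s ≤ U * M * C₀ := by gcongr
  have b4 : 2 * U * ∫ s in (0 : ℝ)..l, |τ s| * g s ≤ 2 * U * (M * (1 - γ + (C₀ - a))) := by gcongr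
  have b5 : σ * (g l - g 0) ≤ (Cl + 1) * U * ((Real.exp C₀ - 1) * q) := by
    have : g l - g 0 = M * (1 - γ) := by rw [hg0γ]; ring
    rw [this]
    have h1 : 0 ≤ M * (1 - γ) := mul_nonneg hM.le (sub_nonneg.2 hγ1)
    calc σ * (M * (1 - γ)) ≤ ((Cl + 1) * U) * (M * (1 - γ)) := by
          gcongr
          exact (le_abs_self _).trans hσ
      _ ≤ _ := by gcongr
  have key := one_add_abs_two_mul_exp_le ha0 haC
  rw [hea] at key
  have b6 : U * M * (1 + |2 * γ - 1| + 2 * (1 - γ + (C₀ - a)) + C₀)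
      ≤ U * ((2 * C₀ + 2) * (Real.exp C₀ * q)) := by
    calc _ ≤ U * M * ((2 * C₀ + 2) * (1 + (C₀ - a) / 2)) := by gcongr
      _ = U * ((2 * C₀ + 2) * (M * (1 + (C₀ - a) / 2))) := by ring
      _ ≤ _ := by gcongr
  refine ⟨?_, (le_mul_of_one_le_right hM.le (by linarith)).trans hqC⟩
  rw [constCV]
  rw [hg0γ, ← hMdef] at b5
  rw [← hMdef] at hα
  rw [hg0γ]
  linarith

/-! ### The unit vorticity field along a vortex line segment. -/

theorem divergence_smul {f : E3 → ℝ} {v : E3 → E3} {x : E3} (hf : DifferentiableAt ℝ f x)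
    (hv : DifferentiableAt ℝ v x) :
    divergence (fun y => f y • v y) x = fderiv ℝ f x (v x) + f x * divergence v x := by
  have h : fderiv ℝ f x (v x) = ∑ i, fderiv ℝ f x (EuclideanSpace.single i 1) * v x i := by
    conv_lhs => rw [E3.eq_sum (v x)]
    simp only [map_add, map_smul, smul_eq_mul, Fin.sum_univ_three]
    ring
  rw [h]
  simp only [divergence, pd, Finset.mul_sum, ← Finset.sum_add_distrib]
  refine Finset.sum_congr rfl fun i _ => ?_
  rw [fderiv_fun_smul hf hv]
  simp
  ring

theorem norm_vorticity_smul_xi (u : ℝ → E3 → E3) (t : ℝ) (x : E3) :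
    ‖vorticity u t x‖ • xi u t x = vorticity u t x := by
  rcases eq_or_ne (vorticity u t x) 0 with h | h
  · simp [h]
  · rw [xi, smul_smul, mul_inv_cancel₀ (norm_ne_zero_iff.2 h), one_smul]

theorem norm_xi {u : ℝ → E3 → E3} {t : ℝ} {x : E3} (h : vorticity u t x ≠ 0) :
    ‖xi u t x‖ = 1 := by
  rw [xi, norm_smul, norm_inv, norm_norm, inv_mul_cancel₀ (norm_ne_zero_iff.2 h)]

/-- The rate of stretching `ξ · ∇u ξ` of the vorticity. -/
def stretchRate (T : ℝ) (u : ℝ → E3 → E3) (t : ℝ) (x : E3) : ℝ :=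
  inner ℝ (velGrad T u (t, x) (xi u t x)) (xi u t x)

namespace IsEulerSolution

variable {T : ℝ} {u : ℝ → E3 → E3} {p : ℝ → E3 → ℝ} {t : ℝ}

theorem contDiffOn_xi (hu : IsEulerSolution T u p) (ht : t ∈ Ico 0 T) :
    ContDiffOn ℝ 1 (xi u t) {x | vorticity u t x ≠ 0} := by
  have h := (hu.contDiff_vorticity ht).contDiffOn (s := {x | vorticity u t x ≠ 0})
  exact ((h.norm ℝ fun x hx => hx).inv fun x hx => norm_ne_zero_iff.2 hx).smul h

theorem isOpen_vorticity_ne_zero (hu : IsEulerSolution T u p) (ht : t ∈ Ico 0 T) :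
    IsOpen {x | vorticity u t x ≠ 0} :=
  isOpen_ne_fun (hu.contDiff_vorticity ht).continuous continuous_const

theorem differentiableAt_xi (hu : IsEulerSolution T u p) (ht : t ∈ Ico 0 T) {x : E3}
    (hx : vorticity u t x ≠ 0) : DifferentiableAt ℝ (xi u t) x :=
  ((hu.contDiffOn_xi ht).contDiffAt ((hu.isOpen_vorticity_ne_zero ht).mem_nhds hx)).differentiableAt
    (by norm_num)

theorem continuousOn_fderiv_xi (hu : IsEulerSolution T u p) (ht : t ∈ Ico 0 T) :
    ContinuousOn (fderiv ℝ (xi u t)) {x | vorticity u t x ≠ 0} :=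
  (hu.contDiffOn_xi ht).continuousOn_fderiv_of_isOpen (hu.isOpen_vorticity_ne_zero ht) le_rfl

/-- The vorticity has vanishing divergence, so that `ξ · ∇|ω| = -τ |ω|`. -/
theorem fderiv_norm_vorticity (hu : IsEulerSolution T u p) (ht : t ∈ Ico 0 T) {x : E3}
    (hx : vorticity u t x ≠ 0) :
    fderiv ℝ (fun y => ‖vorticity u t y‖) x (xi u t x) = -(tau u t x * ‖vorticity u t x‖) := by
  have hω : DifferentiableAt ℝ (vorticity u t) x :=
    (hu.contDiff_vorticity ht).differentiable (by norm_num) x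
  have h := divergence_smul (hω.norm ℝ hx) (hu.differentiableAt_xi ht hx)
  simp only [norm_vorticity_smul_xi] at h
  have h0 := hu.divergence_vorticity ht x
  change divergence (fun y => vorticity u t y) x = 0 at h0
  rw [h0] at h
  rw [tau]
  linarith

section Segment

variable {l : ℝ} {y : ℝ → E3}

theorem continuousOn_xi_segment (hu : IsEulerSolution T u p) (ht : t ∈ Ico 0 T)
    (hω : ∀ s ∈ Icc 0 l, vorticity u t (y s) ≠ 0) (hc : ContinuousOn y (Icc 0 l)) :
    ContinuousOn (fun s => xi u t (y s)) (Icc 0 l) :=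
  (hu.contDiffOn_xi ht).continuousOn.comp hc hω

theorem continuousOn_stretchRate_segment (hu : IsEulerSolution T u p) (ht : t ∈ Ico 0 T)
    (hω : ∀ s ∈ Icc 0 l, vorticity u t (y s) ≠ 0) (hc : ContinuousOn y (Icc 0 l)) :
    ContinuousOn (fun s => stretchRate T u t (y s)) (Icc 0 l) := by
  have hξ := hu.continuousOn_xi_segment ht hω hc
  have hA : ContinuousOn (fun s => velGrad T u (t, y s)) (Icc 0 l) :=
    hu.continuousOn_velGrad.comp (continuousOn_const.prodMk hc) fun s _ => ⟨ht, mem_univ _⟩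
  exact (hA.clm_apply hξ).inner hξ

/-- The abstract estimate applies with `A = u · ξ` and `k = u · (ξ · ∇ξ)`, since the derivative of
`u · ξ` along the line is the stretching rate plus `k`. -/
theorem segment_estimate (hu : IsEulerSolution T u p) (ht : t ∈ Ico 0 T) (hl : 0 < l)
    (hω : ∀ s ∈ Icc 0 l, vorticity u t (y s) ≠ 0)
    (hy : ∀ s ∈ Icc 0 l, HasDerivWithinAt y (xi u t (y s)) (Icc 0 l) s)
    (hmax : ∀ s ∈ Icc 0 l, ‖vorticity u t (y s)‖ ≤ ‖vorticity u t (y l)‖)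
    {C₀ Cl U σ : ℝ} (hκ : ∫ s in (0 : ℝ)..l, |kappa u t (y s)| ≤ C₀)
    (hτ : ∫ s in (0 : ℝ)..l, |tau u t (y s)| ≤ C₀) (hU : ∀ s ∈ Icc 0 l, ‖u t (y s)‖ ≤ U)
    (hCl : 0 ≤ Cl) (hσ : |σ| ≤ (Cl + 1) * U) :
    (∫ s in (0 : ℝ)..l, stretchRate T u t (y s) *
        (2 * ‖vorticity u t (y s)‖ - ‖vorticity u t (y l)‖))
      + σ * (‖vorticity u t (y l)‖ - ‖vorticity u t (y 0)‖)
      ≤ constCV C₀ Cl * U * (1 / l * ∫ s in (0 : ℝ)..l, ‖vorticity u t (y s)‖) ∧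
    ‖vorticity u t (y l)‖ ≤ Real.exp C₀ * (1 / l * ∫ s in (0 : ℝ)..l, ‖vorticity u t (y s)‖) := by
  have hc : ContinuousOn y (Icc 0 l) := fun s hs => (hy s hs).continuousWithinAt
  have hξ := hu.continuousOn_xi_segment ht hω hc
  have hD : ContinuousOn (fun s => fderiv ℝ (xi u t) (y s)) (Icc 0 l) :=
    (hu.continuousOn_fderiv_xi ht).comp hc hω
  have huc : ContinuousOn (fun s => u t (y s)) (Icc 0 l) :=
    hu.continuousOn_spaceTime.comp (continuousOn_const.prodMk hc) fun s _ => ⟨ht, mem_univ _⟩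
  refine integral_stretching_le (g := fun s => ‖vorticity u t (y s)‖) (τ := fun s => tau u t (y s))
    (A := fun s => inner ℝ (u t (y s)) (xi u t (y s)))
    (k := fun s => inner ℝ (u t (y s)) (fderiv ℝ (xi u t) (y s) (xi u t (y s))))
    (κ := fun s => |kappa u t (y s)|) hl (fun s hs => norm_pos_iff.2 (hω s hs)) hmax ?_ ?_ hτ ?_
    (hu.continuousOn_stretchRate_segment ht hω hc) (huc.inner (hD.clm_apply hξ)) ?_ ?_ ?_ hκ hCl hσ
  · intro s hs
    have hd : DifferentiableAt ℝ (fun z => ‖vorticity u t z‖) (y s) :=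
      ((hu.contDiff_vorticity ht).differentiable (by norm_num) (y s)).norm ℝ (hω s hs)
    rw [← hu.fderiv_norm_vorticity ht (hω s hs)]
    exact hd.hasFDerivAt.comp_hasDerivWithinAt s (hy s hs)
  · unfold tau divergence pd
    refine continuousOn_finsetSum _ fun i _ => ?_
    exact (EuclideanSpace.proj i : E3 →L[ℝ] ℝ).continuous.comp_continuousOn
      (hD.clm_apply continuousOn_const)
  · intro s hs
    have h1 : HasDerivWithinAt (fun s => u t (y s)) (velGrad T u (t, y s) (xi u t (y s)))
        (Icc 0 l) s := (hu.hasFDerivAt ht (y s)).comp_hasDerivWithinAt s (hy s hs)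
    have h2 : HasDerivWithinAt (fun s => xi u t (y s)) (fderiv ℝ (xi u t) (y s) (xi u t (y s)))
        (Icc 0 l) s :=
      (hu.differentiableAt_xi ht (hω s hs)).hasFDerivAt.comp_hasDerivWithinAt s (hy s hs)
    exact (h1.inner ℝ h2).congr_deriv (add_comm _ _)
  · intro s hs
    refine (abs_real_inner_le_norm _ _).trans ?_
    rw [norm_xi (hω s hs), mul_one]
    exact hU s hs
  · intro s hs
    refine (abs_real_inner_le_norm _ _).trans ?_
    rw [kappa, abs_norm]
    exact mul_le_mul_of_nonneg_right (hU s hs) (norm_nonneg _)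
  · exact (hD.clm_apply hξ).norm.abs

end Segment

end IsEulerSolution

/-! ### Evolution of the length and the total vorticity in label coordinates. -/

/-- The chain rule for a function of two variables whose first partial derivative is continuous. -/
theorem hasDerivWithinAt_comp_of_continuousWithinAt {E : Type*} [NormedAddCommGroup E]
    [NormedSpace ℝ E] {F F₁ : ℝ → ℝ → E} {I J : Set ℝ} (hI : I.OrdConnected) {c : ℝ → ℝ} {c' t : ℝ}
    {F₂ : E} (hF₁ : ∀ β ∈ I, ∀ s ∈ J, HasDerivWithinAt (fun β => F β s) (F₁ β s) I β)
    (hcont : ContinuousWithinAt (fun q : ℝ × ℝ => F₁ q.1 q.2) (I ×ˢ J) (c t, t)) (ht : t ∈ J)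
    (hF₂ : HasDerivWithinAt (F (c t)) F₂ J t) (hcm : ∀ s ∈ J, c s ∈ I)
    (hc : HasDerivWithinAt c c' J t) :
    HasDerivWithinAt (fun s => F (c s) s) (F₂ + c' • F₁ (c t) t) J t := by
  have h1 : (fun s => F (c s) s - F (c t) s - (c s - c t) • F₁ (c t) t) =o[𝓝[J] t]
      fun s => s - t := by
    refine IsLittleO.trans_isBigO ?_ hc.differentiableWithinAt.isBigO_sub
    rw [isLittleO_iff]
    intro ε hε
    rw [Metric.continuousWithinAt_iff] at hcont
    obtain ⟨δ, hδ, hδ'⟩ := hcont ε hε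
    filter_upwards [self_mem_nhdsWithin, mem_nhdsWithin_of_mem_nhds (Metric.ball_mem_nhds t hδ),
      hc.continuousWithinAt.eventually (Metric.ball_mem_nhds _ hδ)] with s hs hst hcs
    have hconv : Convex ℝ (I ∩ Metric.ball (c t) δ) := hI.convex.inter (convex_ball _ _)
    have := hconv.norm_image_sub_le_of_norm_hasDerivWithin_le
      (f := fun r => F r s - r • F₁ (c t) t) (f' := fun r => F₁ r s - (1 : ℝ) • F₁ (c t) t)
      (C := ε) (x := c t) (y := c s) (fun r hr =>
        ((hF₁ r hr.1 s hs).mono inter_subset_left).sub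
          ((hasDerivWithinAt_id r _).smul_const _)) ?_ ⟨hcm t ht, Metric.mem_ball_self hδ⟩
      ⟨hcm s hs, hcs⟩
    · refine (le_of_eq (congrArg _ ?_)).trans this
      rw [sub_smul]
      abel
    · intro r hr
      rw [one_smul, ← dist_eq_norm]
      refine (hδ' (x := (r, s)) ⟨hr.1, hs⟩ ?_).le
      rw [Prod.dist_eq]
      exact max_lt hr.2 hst
  have h2 := hasDerivWithinAt_iff_isLittleO.1 hF₂
  have h3 := hasDerivWithinAt_iff_isLittleO.1 (hc.smul_const (F₁ (c t) t))
  rw [hasDerivWithinAt_iff_isLittleO]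
  refine ((h1.add h2).add h3).congr (fun s => ?_) fun _ => rfl
  rw [sub_smul, smul_add]
  abel

namespace IsCarriedVortexLine

variable {T T₀ : ℝ} {u : ℝ → E3 → E3} {p : ℝ → E3 → ℝ} {I : Set ℝ} {Y : ℝ → ℝ → E3}

theorem continuousOn_vorticity (hY : IsCarriedVortexLine u T₀ T I Y) (hu : IsEulerSolution T u p)
    (hT₀ : 0 ≤ T₀) :
    ContinuousOn (fun q : ℝ × ℝ => vorticity u q.2 (Y q.1 q.2)) (I ×ˢ Ico T₀ T) :=
  hu.continuousOn_vorticity.comp (continuousOn_snd.prodMk (hY.continuousOn_prod hu hT₀))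
    fun _ hq => ⟨⟨hT₀.trans hq.2.1, hq.2.2⟩, mem_univ _⟩

theorem continuousOn_stretchRate (hY : IsCarriedVortexLine u T₀ T I Y) (hu : IsEulerSolution T u p)
    (hT₀ : 0 ≤ T₀) :
    ContinuousOn (fun q : ℝ × ℝ => stretchRate T u q.2 (Y q.1 q.2)) (I ×ˢ Ico T₀ T) := by
  have hω := hY.continuousOn_vorticity hu hT₀
  have hξ : ContinuousOn (fun q : ℝ × ℝ => xi u q.2 (Y q.1 q.2)) (I ×ˢ Ico T₀ T) :=
    (hω.norm.inv₀ fun q hq => norm_ne_zero_iff.2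
      (hY.vorticity_ne_zero hu hT₀ hq.2 hq.1)).smul hω
  have hA : ContinuousOn (fun q : ℝ × ℝ => velGrad T u (q.2, Y q.1 q.2)) (I ×ˢ Ico T₀ T) :=
    hu.continuousOn_velGrad.comp (continuousOn_snd.prodMk (hY.continuousOn_prod hu hT₀))
      fun _ hq => ⟨⟨hT₀.trans hq.2.1, hq.2.2⟩, mem_univ _⟩
  exact (hA.clm_apply hξ).inner hξ

theorem continuousOn_initial_inv (hY : IsCarriedVortexLine u T₀ T I Y)
    (hu : IsEulerSolution T u p) (hT₀ : T₀ ∈ Ico 0 T) :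
    ContinuousOn (fun β => ‖vorticity u T₀ (Y β T₀)‖⁻¹) I := by
  have h : ContinuousOn (fun β => vorticity u T₀ (Y β T₀)) I :=
    (hY.continuousOn_vorticity hu hT₀.1).comp (continuousOn_id.prodMk continuousOn_const)
      fun β hβ => ⟨hβ, ⟨le_rfl, hT₀.2⟩⟩
  exact h.norm.inv₀ fun β hβ => norm_ne_zero_iff.2 (hY.initial_ne_zero β hβ)

theorem hasDerivWithinAt_norm_vorticity (hY : IsCarriedVortexLine u T₀ T I Y)
    (hu : IsEulerSolution T u p) (hT₀ : 0 ≤ T₀) {t : ℝ} (ht : t ∈ Ico T₀ T) {β : ℝ} (hβ : β ∈ I) :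
    HasDerivWithinAt (fun t => ‖vorticity u t (Y β t)‖)
      (stretchRate T u t (Y β t) * ‖vorticity u t (Y β t)‖) (Ico T₀ T) t := by
  have hne := norm_ne_zero_iff.2 (hY.vorticity_ne_zero hu hT₀ ht hβ)
  have h := (hY.hasDerivWithinAt_vorticity hu hT₀ ht hβ).norm_sq.sqrt (pow_ne_zero 2 hne)
  simp only [Real.sqrt_sq (norm_nonneg _)] at h
  refine h.congr_deriv ?_
  rw [stretchRate, xi, map_smul, real_inner_smul_left, real_inner_smul_right, real_inner_comm]
  field_simp

end IsCarriedVortexLine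

namespace IsVortexSegmentFamily

variable {T T₀ : ℝ} {u : ℝ → E3 → E3} {p : ℝ → E3 → ℝ} {x : ℝ → ℝ → E3} {L : ℝ → ℝ}

theorem continuousOn (hx : IsVortexSegmentFamily u T₀ T x L) {t : ℝ} (ht : t ∈ Ico T₀ T) :
    ContinuousOn (fun s => x s t) (Icc 0 (L t)) :=
  fun s hs => (hx.tangent t ht s hs).continuousWithinAt

/-- Along a vortex line segment at time `t`, the arclength at the initial time is a function of the
arclength with derivative `|ω₀| / |ω|`. -/
theorem hasDerivWithinAt_label (hx : IsVortexSegmentFamily u T₀ T x L)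
    (hu : IsEulerSolution T u p) (hT₀ : 0 ≤ T₀) {I : Set ℝ} {Y b : ℝ → ℝ → _}
    (hY : IsCarriedVortexLine u T₀ T I Y)
    (hb : ∀ t ∈ Ico T₀ T, ∀ s ∈ Icc 0 (L t), b s t ∈ I ∧ x s t = Y (b s t) t)
    {t : ℝ} (ht : t ∈ Ico T₀ T) (hbd : DifferentiableOn ℝ (fun s => b s t) (Icc 0 (L t)))
    {s : ℝ} (hs : s ∈ Icc 0 (L t)) :
    HasDerivWithinAt (fun s => b s t)
      (‖vorticity u T₀ (Y (b s t) T₀)‖ * ‖vorticity u t (x s t)‖⁻¹) (Icc 0 (L t)) s := by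
  obtain ⟨hbI, hxY⟩ := hb t ht s hs
  have hd := (hbd s hs).hasDerivWithinAt
  set d := derivWithin (fun s => b s t) (Icc 0 (L t)) s
  -- Differentiating `x = Y ∘ b` gives one tangent and the arclength condition another. Both are
  -- multiples of the nonzero `ω`, so comparing coefficients determines the derivative of `b`.
  have h1 := (hY.hasDerivWithinAt_label hu hT₀ ht hbI).scomp s hd fun r hr => (hb t ht r hr).1
  have h2 := (hx.tangent t ht s hs).congr_of_mem (f₁ := (fun β => Y β t) ∘ fun s => b s t)
    (fun r hr => ((hb t ht r hr).2).symm) hs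
  have h3 := (uniqueDiffOn_Icc (hx.length_pos t ht) s hs).eq_deriv _ h1 h2
  have hω := hx.vorticity_ne_zero t ht s hs
  have h0 := norm_ne_zero_iff.2 (hY.initial_ne_zero _ hbI)
  rw [← hxY, xi, smul_smul] at h3
  have h4 := smul_left_injective ℝ hω h3
  refine hd.congr_deriv ?_
  rw [← h4]
  field_simp

/-- Change of variables from the arclength to the label. -/
theorem integral_eq_integral_label (hx : IsVortexSegmentFamily u T₀ T x L)
    (hu : IsEulerSolution T u p) (hT₀ : T₀ ∈ Ico 0 T) {I : Set ℝ} {Y b : ℝ → ℝ → _}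
    (hY : IsCarriedVortexLine u T₀ T I Y)
    (hb : ∀ t ∈ Ico T₀ T, ∀ s ∈ Icc 0 (L t), b s t ∈ I ∧ x s t = Y (b s t) t)
    {t : ℝ} (ht : t ∈ Ico T₀ T) (hbd : DifferentiableOn ℝ (fun s => b s t) (Icc 0 (L t)))
    {h : ℝ → ℝ} (hh : ContinuousOn h I) :
    ∫ s in (0 : ℝ)..L t, h (b s t) = ∫ β in b 0 t..b (L t) t,
      h β * (‖vorticity u t (Y β t)‖ * ‖vorticity u T₀ (Y β T₀)‖⁻¹) := by
  have hl := hx.length_pos t ht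
  have hbc : ContinuousOn (fun s => b s t) (Icc 0 (L t)) := hbd.continuousOn
  have hmap : MapsTo (fun s => b s t) (Icc 0 (L t)) I := fun s hs => (hb t ht s hs).1
  have hj : ContinuousOn (fun β => vorticity u T₀ (Y β T₀)) I :=
    (hY.continuousOn_vorticity hu hT₀.1).comp (continuousOn_id.prodMk continuousOn_const)
      fun β hβ => ⟨hβ, ⟨le_rfl, hT₀.2⟩⟩
  have hJ : ContinuousOn (fun β => vorticity u t (Y β t)) I :=
    (hY.continuousOn_vorticity hu hT₀.1).comp (continuousOn_id.prodMk continuousOn_const)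
      fun β hβ => ⟨hβ, ht⟩
  have hg : ContinuousOn (fun β => h β * (‖vorticity u t (Y β t)‖ * ‖vorticity u T₀ (Y β T₀)‖⁻¹)) I :=
    hh.mul (hJ.norm.mul (hY.continuousOn_initial_inv hu hT₀))
  have hb' : ContinuousOn (fun s => ‖vorticity u T₀ (Y (b s t) T₀)‖ * ‖vorticity u t (x s t)‖⁻¹)
      (Icc 0 (L t)) := by
    refine ((hj.comp hbc hmap).norm).mul (ContinuousOn.inv₀ ?_ fun s hs => norm_ne_zero_iff.2
      (hx.vorticity_ne_zero t ht s hs))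
    exact ((hu.contDiff_vorticity ⟨hT₀.1.trans ht.1, ht.2⟩).continuous.comp_continuousOn
      (hx.continuousOn ht)).norm
  have hu' : uIcc 0 (L t) = Icc 0 (L t) := uIcc_of_le hl.le
  rw [← intervalIntegral.integral_comp_mul_deriv'' (f := fun s => b s t)
    (f' := fun s => ‖vorticity u T₀ (Y (b s t) T₀)‖ * ‖vorticity u t (x s t)‖⁻¹)
    (by rwa [hu']) ?_ (by rwa [hu']) (hg.mono (by rw [hu']; exact hmap.image_subset))]
  · refine intervalIntegral.integral_congr fun s hs => ?_
    rw [hu'] at hs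
    have h0 := norm_ne_zero_iff.2 (hY.initial_ne_zero _ (hb t ht s hs).1)
    have hω := norm_ne_zero_iff.2 (hx.vorticity_ne_zero t ht s hs)
    simp only [Function.comp_apply, ← (hb t ht s hs).2]
    field_simp
  · intro s hs
    rw [min_eq_left hl.le, max_eq_right hl.le] at hs
    exact ((hx.hasDerivWithinAt_label hu hT₀.1 hY hb ht hbd ⟨hs.1.le, hs.2.le⟩).hasDerivAt
      (Icc_mem_nhds hs.1 hs.2)).hasDerivWithinAt

/-- The evolution of the integrals of powers of the vorticity over the vortex line segments. Here
`σ₀` and `σ₁` are the velocities of the end points along the vortex line, relative to the flow. -/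
theorem exists_hasDerivWithinAt (hx : IsVortexSegmentFamily u T₀ T x L)
    (hu : IsEulerSolution T u p) (hT₀ : T₀ ∈ Ico 0 T) :
    ∃ σ₀ σ₁ : ℝ → ℝ, ∀ t ∈ Ico T₀ T,
      HasDerivWithinAt (fun t => x 0 t) (u t (x 0 t) + σ₀ t • xi u t (x 0 t)) (Ico T₀ T) t ∧
      ∀ m : ℕ, HasDerivWithinAt (fun t => ∫ s in (0 : ℝ)..L t, ‖vorticity u t (x s t)‖ ^ m)
        ((∫ s in (0 : ℝ)..L t, (m + 1) * stretchRate T u t (x s t) * ‖vorticity u t (x s t)‖ ^ m)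
          + ‖vorticity u t (x (L t) t)‖ ^ m * σ₁ t - ‖vorticity u t (x 0 t)‖ ^ m * σ₀ t)
        (Ico T₀ T) t := by
  obtain ⟨I, Y, b, hY, hb, hbd, hb0, hb1⟩ := hx.same_line
  set j : ℝ → ℝ := fun β => ‖vorticity u T₀ (Y β T₀)‖⁻¹ with hj
  set J : ℝ → ℝ → ℝ := fun β t => ‖vorticity u t (Y β t)‖ with hJ
  have hjc : ContinuousOn j I := hY.continuousOn_initial_inv hu hT₀
  have hωc := hY.continuousOn_vorticity hu hT₀.1
  have hαc := hY.continuousOn_stretchRate hu hT₀.1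
  have hjc' : ContinuousOn (fun q : ℝ × ℝ => j q.1) (I ×ˢ Ico T₀ T) :=
    hjc.comp continuousOn_fst fun q hq => hq.1
  have hl0 : ∀ t ∈ Ico T₀ T, (0 : ℝ) ∈ Icc 0 (L t) := fun t ht => ⟨le_rfl, (hx.length_pos t ht).le⟩
  have hl1 : ∀ t ∈ Ico T₀ T, L t ∈ Icc 0 (L t) := fun t ht => ⟨(hx.length_pos t ht).le, le_rfl⟩
  -- The speed of the end point's label, converted to arclength by `ds/dβ = j J`.
  refine ⟨fun t => derivWithin (fun t => b 0 t) (Ico T₀ T) t * (j (b 0 t) * J (b 0 t) t),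
    fun t => derivWithin (fun t => b (L t) t) (Ico T₀ T) t * (j (b (L t) t) * J (b (L t) t) t),
    fun t ht => ⟨?_, fun m => ?_⟩⟩
  · obtain ⟨hbI, hxY⟩ := hb t ht 0 (hl0 t ht)
    have h := hasDerivWithinAt_comp_of_continuousWithinAt (F := Y)
      (F₁ := fun β t => j β • vorticity u t (Y β t)) hY.ordConnected (J := Ico T₀ T)
      (fun β hβ s hs => hY.hasDerivWithinAt_label hu hT₀.1 hs hβ)
      ((hjc'.smul hωc) (b 0 t, t) ⟨hbI, ht⟩) ht (hY.carried _ hbI t ht)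
      (fun s hs => (hb s hs 0 (hl0 s hs)).1) (hb0 t ht).hasDerivWithinAt
    refine (h.congr (fun s hs => (hb s hs 0 (hl0 s hs)).2) hxY).congr_deriv ?_
    rw [← hxY, mul_smul, mul_smul]
    simp only [hJ]
    rw [← hxY, norm_vorticity_smul_xi]
  · obtain ⟨t₁, ht₁, ht₁T⟩ := exists_between ht.2
    have hsub : Icc T₀ t₁ ⊆ Ico T₀ T := fun s hs => ⟨hs.1, hs.2.trans_lt ht₁T⟩
    have htI : t ∈ Icc T₀ t₁ := ⟨ht.1, ht₁.le⟩
    -- The interval `I` need not be closed. The end point labels over a compact time interval form a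
    -- compact subset of `I`, whose least and greatest elements span a compact label range.
    obtain ⟨A, B, hAI, hBI, hcm, hdm⟩ : ∃ A B, A ∈ I ∧ B ∈ I ∧
        (∀ s ∈ Icc T₀ t₁, b 0 s ∈ Icc A B) ∧ ∀ s ∈ Icc T₀ t₁, b (L s) s ∈ Icc A B := by
      have hK : IsCompact ((fun t => b 0 t) '' Icc T₀ t₁ ∪ (fun t => b (L t) t) '' Icc T₀ t₁) :=
        (isCompact_Icc.image_of_continuousOn (hb0.continuousOn.mono hsub)).union
          (isCompact_Icc.image_of_continuousOn (hb1.continuousOn.mono hsub))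
      have hKI : (fun t => b 0 t) '' Icc T₀ t₁ ∪ (fun t => b (L t) t) '' Icc T₀ t₁ ⊆ I := by
        rintro _ (⟨s, hs, rfl⟩ | ⟨s, hs, rfl⟩)
        · exact (hb s (hsub hs) 0 (hl0 s (hsub hs))).1
        · exact (hb s (hsub hs) (L s) (hl1 s (hsub hs))).1
      have hne : ((fun t => b 0 t) '' Icc T₀ t₁ ∪ (fun t => b (L t) t) '' Icc T₀ t₁).Nonempty :=
        ⟨_, Or.inl ⟨t, htI, rfl⟩⟩
      obtain ⟨A, hA, hA'⟩ := hK.exists_isLeast hne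
      obtain ⟨B, hB, hB'⟩ := hK.exists_isGreatest hne
      exact ⟨A, B, hKI hA, hKI hB, fun s hs => ⟨hA' (Or.inl ⟨s, hs, rfl⟩), hB' (Or.inl ⟨s, hs, rfl⟩)⟩,
        fun s hs => ⟨hA' (Or.inr ⟨s, hs, rfl⟩), hB' (Or.inr ⟨s, hs, rfl⟩)⟩⟩
    have hABI : Icc A B ⊆ I := hY.ordConnected.out hAI hBI
    have hprod : Icc A B ×ˢ Icc T₀ t₁ ⊆ I ×ˢ Ico T₀ T := prod_mono hABI hsub
    have h := hasDerivWithinAt_integral_of_continuousOn₂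
      -- The extra factor `J j` is the arclength element; it grows at the same rate `α` as `J`,
      -- hence the factor `m + 1` in the derivative.
      (F := fun β t => J β t ^ m * (J β t * j β))
      (F' := fun β t => (m + 1) * stretchRate T u t (Y β t) * J β t ^ m * (J β t * j β))
      (a := T₀) (b := t₁) (A := A) (B := B) (t := t)
      (((hωc.norm.pow m).mul (hωc.norm.mul hjc')).mono hprod)
      ((((continuousOn_const.mul hαc).mul (hωc.norm.pow m)).mul (hωc.norm.mul hjc')).mono hprod)
      (fun β hβ s hs => ?_) htI hcm hdm ((hb0 t ht).hasDerivWithinAt.mono hsub)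
      ((hb1 t ht).hasDerivWithinAt.mono hsub)
    · have hnhds : Icc T₀ t₁ ∈ 𝓝[Ico T₀ T] t := by
        filter_upwards [self_mem_nhdsWithin, mem_nhdsWithin_of_mem_nhds (Iio_mem_nhds ht₁)]
          with s hs hs' using ⟨hs.1, le_of_lt hs'⟩
      have hJc : ∀ s ∈ Ico T₀ T, ContinuousOn (fun β => J β s) I := fun s hs =>
        hωc.norm.comp (f := fun β : ℝ => (β, s)) (continuousOn_id.prodMk continuousOn_const)
          fun β hβ => ⟨hβ, hs⟩
      have hαs : ContinuousOn (fun β => stretchRate T u t (Y β t)) I :=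
        hαc.comp (f := fun β : ℝ => (β, t)) (continuousOn_id.prodMk continuousOn_const)
          fun β hβ => ⟨hβ, ht⟩
      have e : ∀ s ∈ Ico T₀ T, ∫ r in (0 : ℝ)..L s, ‖vorticity u s (x r s)‖ ^ m
          = ∫ β in b 0 s..b (L s) s, J β s ^ m * (J β s * j β) := by
        intro s hs
        rw [← hx.integral_eq_integral_label hu hT₀ hY hb hs (hbd s hs)
          (h := fun β => J β s ^ m) ((hJc s hs).pow m)]
        refine intervalIntegral.integral_congr fun r hr => ?_
        rw [uIcc_of_le (hx.length_pos s hs).le] at hr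
        simp only [hJ, (hb s hs r hr).2]
      have e' : ∫ r in (0 : ℝ)..L t,
          (m + 1) * stretchRate T u t (x r t) * ‖vorticity u t (x r t)‖ ^ m
          = ∫ β in b 0 t..b (L t) t,
            (m + 1) * stretchRate T u t (Y β t) * J β t ^ m * (J β t * j β) := by
        rw [← hx.integral_eq_integral_label hu hT₀ hY hb ht (hbd t ht)
          (h := fun β => (m + 1) * stretchRate T u t (Y β t) * J β t ^ m)
          ((continuousOn_const.mul hαs).mul ((hJc t ht).pow m))]
        refine intervalIntegral.integral_congr fun r hr => ?_
        rw [uIcc_of_le (hx.length_pos t ht).le] at hr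
        simp only [hJ, (hb t ht r hr).2]
      refine ((h.mono_of_mem_nhdsWithin hnhds).congr e (e t ht)).congr_deriv ?_
      rw [e', (hb t ht 0 (hl0 t ht)).2, (hb t ht _ (hl1 t ht)).2]
      ring
    · have hJd := (hY.hasDerivWithinAt_norm_vorticity hu hT₀.1 (hsub hs) (hABI hβ)).mono hsub
      refine ((hJd.fun_pow m).mul (hJd.mul_const (j β))).congr_deriv ?_
      simp only [hJ]
      rcases m with _ | m
      · simp; ring
      · simp only [Nat.add_sub_cancel, pow_succ]
        push_cast
        ring
end IsVortexSegmentFamily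

/-! ### Grönwall's inequality and comparison of the maxima. -/

/-- Grönwall's inequality for linear differential inequalities with continuous coefficient. -/
theorem le_mul_exp_integral_of_hasDerivAt_le {y y' c : ℝ → ℝ} {a b : ℝ} (hab : a ≤ b)
    (hy : ContinuousOn y (Icc a b)) (hy' : ∀ t ∈ Ioo a b, HasDerivAt y (y' t) t)
    (hc : ContinuousOn c (Icc a b)) (hle : ∀ t ∈ Ioo a b, y' t ≤ c t * y t) :
    y b ≤ y a * Real.exp (∫ t in a..b, c t) := by
  have hcd : ∀ t ∈ Ioo a b, HasDerivAt (fun t => ∫ s in a..t, c s) (c t) t := by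
    intro t ht
    have hn : Icc a b ∈ 𝓝 t := Icc_mem_nhds ht.1 ht.2
    refine intervalIntegral.integral_hasDerivAt_right
      ((hc.mono (Icc_subset_Icc_right ht.2.le)).intervalIntegrable_of_Icc ht.1.le) ?_
      (hc.continuousAt hn)
    exact ⟨Icc a b, hn, hc.aestronglyMeasurable measurableSet_Icc⟩
  have hcc : ContinuousOn (fun t => ∫ s in a..t, c s) (Icc a b) := by
    have := intervalIntegral.continuousOn_primitive_interval (μ := volume) (f := c) (a := a) (b := b)
      ((hc.mono (uIcc_of_le hab).subset).integrableOn_compact isCompact_uIcc)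
    rwa [uIcc_of_le hab] at this
  have hanti : AntitoneOn (fun t => y t * Real.exp (-∫ s in a..t, c s)) (Icc a b) := by
    have hd : ∀ t ∈ Ioo a b, HasDerivAt (fun t => y t * Real.exp (-∫ s in a..t, c s))
        (y' t * Real.exp (-∫ s in a..t, c s)
          + y t * (Real.exp (-∫ s in a..t, c s) * -c t)) t := fun t ht =>
      (hy' t ht).mul (hcd t ht).neg.exp
    refine antitoneOn_of_deriv_nonpos (convex_Icc a b) (hy.mul hcc.neg.rexp) ?_ ?_
    · rw [interior_Icc]
      exact fun t ht => (hd t ht).differentiableAt.differentiableWithinAt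
    · rw [interior_Icc]
      intro t ht
      rw [(hd t ht).deriv]
      have := mul_le_mul_of_nonneg_right (hle t ht) (Real.exp_pos (-∫ s in a..t, c s)).le
      linarith
  have h := hanti ⟨le_rfl, hab⟩ ⟨hab, le_rfl⟩ hab
  simp only [intervalIntegral.integral_same, neg_zero, Real.exp_zero, mul_one] at h
  rw [Real.exp_neg, ← div_eq_mul_inv, div_le_iff₀ (Real.exp_pos _)] at h
  exact h

theorem constCV_nonneg {C₀ Cl : ℝ} (hC₀ : 0 ≤ C₀) (hCl : 0 ≤ Cl) : 0 ≤ constCV C₀ Cl := by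
  have := Real.one_le_exp hC₀
  have : 0 ≤ (Real.exp C₀ - 1) * (Cl + 1) := mul_nonneg (by linarith) (by linarith)
  rw [constCV]
  positivity

theorem IsEulerSolution.Omega_pos {T : ℝ} {u : ℝ → E3 → E3} {p : ℝ → E3 → ℝ} {t : ℝ}
    (hu : IsEulerSolution T u p) (ht : t ∈ Ico 0 T) (hΩ : eLpNorm (vorticity u t) ∞ volume < ∞)
    {x : E3} (hx : vorticity u t x ≠ 0) : 0 < Omega u t := by
  have hc := (hu.contDiff_vorticity ht).continuous
  refine ENNReal.toReal_pos (fun h => hx ?_) hΩ.ne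
  -- A zero essential supremum only gives vanishing almost everywhere; continuity makes it
  -- everywhere.
  rw [eLpNorm_eq_zero_iff hc.aestronglyMeasurable (by simp)] at h
  have := (Continuous.ae_eq_iff_eq volume hc continuous_const).1 h
  exact congrFun this x

namespace IsVortexSegmentFamily

variable {T T₀ : ℝ} {u : ℝ → E3 → E3} {p : ℝ → E3 → ℝ} {x : ℝ → ℝ → E3} {L : ℝ → ℝ} {t : ℝ}

theorem le_segMax (hx : IsVortexSegmentFamily u T₀ T x L) (ht : t ∈ Ico T₀ T) {f : E3 → ℝ}
    (hf : Continuous f) {s : ℝ} (hs : s ∈ Icc 0 (L t)) : f (x s t) ≤ segMax x L t f :=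
  le_csSup (isCompact_Icc.bddAbove_image (hf.comp_continuousOn (hx.continuousOn ht)))
    ⟨s, hs, rfl⟩

theorem Vmax_le (hx : IsVortexSegmentFamily u T₀ T x L) (hu : IsEulerSolution T u p)
    (hT₀ : 0 ≤ T₀) (ht : t ∈ Ico T₀ T) : Vmax u x L t ≤ segMax x L t fun y => ‖u t y‖ := by
  have hc : Continuous (u t) := continuous_iff_continuousAt.2 fun y =>
    (hu.hasFDerivAt ⟨hT₀.trans ht.1, ht.2⟩ y).continuousAt
  refine csSup_le ⟨_, 0, ⟨le_rfl, (hx.length_pos t ht).le⟩, rfl⟩ ?_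
  rintro _ ⟨s, hs, rfl⟩
  refine (abs_real_inner_le_norm _ _).trans ?_
  rw [norm_xi (hx.vorticity_ne_zero t ht s hs), mul_one]
  exact hx.le_segMax ht hc.norm hs

theorem meanVorticity_le (hx : IsVortexSegmentFamily u T₀ T x L) (hu : IsEulerSolution T u p)
    (hT₀ : 0 ≤ T₀) (ht : t ∈ Ico T₀ T) : meanVorticity u x L t ≤ OmegaL u x L t := by
  have hl := hx.length_pos t ht
  have hc := (hu.contDiff_vorticity (t := t) ⟨hT₀.trans ht.1, ht.2⟩).continuous.norm
  have h : ∫ s in (0 : ℝ)..L t, ‖vorticity u t (x s t)‖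
      ≤ ∫ _ in (0 : ℝ)..L t, OmegaL u x L t :=
    intervalIntegral.integral_mono_on hl.le
      ((hc.comp_continuousOn (hx.continuousOn ht)).intervalIntegrable_of_Icc hl.le)
      intervalIntegrable_const fun s hs => hx.le_segMax ht hc hs
  rw [intervalIntegral.integral_const, smul_eq_mul, sub_zero] at h
  rw [meanVorticity, segIntegral, one_div, ← div_eq_inv_mul, div_le_iff₀ hl]
  linarith

end IsVortexSegmentFamily

end

/-! ### The differential inequality for the logarithm of the mean vorticity. -/

theorem mainTheorem3 (T T₀ : ℝ) (hT₀ : T₀ ∈ Set.Ico 0 T)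
    (u : ℝ → E3 → E3) (p : ℝ → E3 → ℝ) (hu : IsEulerSolution T u p)
    (hΩ : ∀ t ∈ Set.Ico T₀ T, eLpNorm (vorticity u t) ∞ volume < ∞)
    (x : ℝ → ℝ → E3) (L : ℝ → ℝ) (hx : IsVortexSegmentFamily u T₀ T x L)
    (hL : AntitoneOn L (Set.Ico T₀ T))
    (c₀ C₀ Cl Cu : ℝ) (hc₀ : 0 < c₀) (hc₀' : c₀ ≤ 1) (hC₀ : 0 < C₀) (hCl : 0 < Cl) (hCu : 0 < Cu)
    (hmax : ∀ t ∈ Set.Ico T₀ T, c₀ * Omega u t ≤ OmegaL u x L t)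
    (hend : ∀ t ∈ Set.Ico T₀ T, ‖vorticity u t (x (L t) t)‖ = OmegaL u x L t)
    (hκ : ∀ t ∈ Set.Ico T₀ T, segIntegral x L t (fun y => |kappa u t y|) ≤ C₀)
    (hτ : ∀ t ∈ Set.Ico T₀ T, segIntegral x L t (fun y => |tau u t y|) ≤ C₀)
    (hstart : ∀ t ∈ Set.Ico T₀ T,
      |inner ℝ (derivWithin (fun t' => x 0 t') (Set.Ico T₀ T) t) (xi u t (x 0 t))|
        ≤ Cl * Vmax u x L t)
    (hvel : ∀ t ∈ Set.Ico T₀ T, segMax x L t (fun y => ‖u t y‖) ≤ Cu * Real.log (Omega u t)) :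
    ∀ t ∈ Set.Ico T₀ T,
      Omega u t ≤ Real.exp (Real.log (Real.exp C₀ / c₀ * meanVorticity u x L T₀) *
        Real.exp (∫ t' in T₀..t, Cu * max (constCU C₀) (constCV C₀ Cl) / L t')) := by
  obtain ⟨σ₀, σ₁, hσ⟩ := hx.exists_hasDerivWithinAt hu hT₀
  have h0T : ∀ t ∈ Ico T₀ T, t ∈ Ico 0 T := fun t ht => ⟨hT₀.1.trans ht.1, ht.2⟩
  have hl := hx.length_pos
  have hs0 : ∀ t ∈ Ico T₀ T, (0 : ℝ) ∈ Icc 0 (L t) := fun t ht => ⟨le_rfl, (hl t ht).le⟩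
  have hs1 : ∀ t ∈ Ico T₀ T, L t ∈ Icc 0 (L t) := fun t ht => ⟨(hl t ht).le, le_rfl⟩
  have hωc : ∀ t ∈ Ico T₀ T, Continuous (vorticity u t) := fun t ht =>
    (hu.contDiff_vorticity (h0T t ht)).continuous
  have huc : ∀ t ∈ Ico T₀ T, Continuous (u t) := fun t ht =>
    continuous_iff_continuousAt.2 fun y => (hu.hasFDerivAt (h0T t ht) y).continuousAt
  set U : ℝ → ℝ := fun t => segMax x L t fun y => ‖u t y‖
  set Q : ℝ → ℝ := meanVorticity u x L with hQdef
  have hU : ∀ t ∈ Ico T₀ T, ∀ s ∈ Icc 0 (L t), ‖u t (x s t)‖ ≤ U t := fun t ht s hs =>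
    hx.le_segMax ht (huc t ht).norm hs
  have hU0 : ∀ t ∈ Ico T₀ T, 0 ≤ U t := fun t ht =>
    (norm_nonneg _).trans (hU t ht 0 (hs0 t ht))
  -- Here `σ₀ = (dx(0,t)/dt - u) · ξ`: the first term is at most `Cl V ≤ Cl U`, the second at most
  -- `U`.
  have hσ₀ : ∀ t ∈ Ico T₀ T, |σ₀ t| ≤ (Cl + 1) * U t := by
    intro t ht
    have h1 := hstart t ht
    have hω := hx.vorticity_ne_zero t ht 0 (hs0 t ht)
    rw [(hσ t ht).1.derivWithin (uniqueDiffOn_Ico T₀ T t ht), inner_add_left,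
      real_inner_smul_left, real_inner_self_eq_norm_sq, norm_xi hω, one_pow, mul_one] at h1
    have h2 : |inner ℝ (u t (x 0 t)) (xi u t (x 0 t))| ≤ U t := by
      refine (abs_real_inner_le_norm _ _).trans ?_
      rw [norm_xi hω, mul_one]
      exact hU t ht 0 (hs0 t ht)
    have h3 := mul_le_mul_of_nonneg_left (hx.Vmax_le hu hT₀.1 ht) hCl.le
    have h4 := abs_sub_abs_le_abs_add (σ₀ t) (inner ℝ (u t (x 0 t)) (xi u t (x 0 t)))
    rw [add_comm (σ₀ t)] at h4
    change Cl * Vmax u x L t ≤ Cl * U t at h3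
    linarith
  have hest := fun t ht => hu.segment_estimate (h0T t ht) (hl t ht) (hx.vorticity_ne_zero t ht)
    (hx.tangent t ht) (fun s hs => (hend t ht).symm ▸ hx.le_segMax ht (hωc t ht).norm hs)
    (hκ t ht) (hτ t ht) (hU t ht) hCl.le (hσ₀ t ht)
  have hQle : ∀ t ∈ Ico T₀ T, Q t ≤ ‖vorticity u t (x (L t) t)‖ := fun t ht =>
    (hend t ht).symm ▸ hx.meanVorticity_le hu hT₀.1 ht
  have hΩpos : ∀ t ∈ Ico T₀ T, 0 < Omega u t := fun t ht =>
    hu.Omega_pos (h0T t ht) (hΩ t ht) (hx.vorticity_ne_zero t ht 0 (hs0 t ht))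
  have hQpos : ∀ t ∈ Ico T₀ T, 0 < Q t := by
    intro t ht
    have h1 := (norm_pos_iff.2 (hx.vorticity_ne_zero t ht _ (hs1 t ht))).trans_le (hest t ht).2
    exact pos_of_mul_pos_right h1 (Real.exp_pos _).le
  have hΩQ : ∀ t ∈ Ico T₀ T, Omega u t ≤ Real.exp C₀ / c₀ * Q t := by
    intro t ht
    have h1 := (hest t ht).2
    rw [hend t ht] at h1
    have h2 : c₀ * Omega u t ≤ Real.exp C₀ * Q t := (hmax t ht).trans h1
    rw [div_mul_eq_mul_div, le_div_iff₀ hc₀]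
    linarith
  set y : ℝ → ℝ := fun t => Real.log (Real.exp C₀ / c₀ * Q t) with hy
  have hlogy : ∀ t ∈ Ico T₀ T, Real.log (Omega u t) ≤ y t := fun t ht =>
    Real.log_le_log (hΩpos t ht) (hΩQ t ht)
  have hUy : ∀ t ∈ Ico T₀ T, U t ≤ Cu * y t := fun t ht =>
    (hvel t ht).trans (mul_le_mul_of_nonneg_left (hlogy t ht) hCu.le)
  set α : ℝ → ℝ → ℝ := fun t s => stretchRate T u t (x s t) with hα
  set g : ℝ → ℝ → ℝ := fun t s => ‖vorticity u t (x s t)‖ with hg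
  set L' : ℝ → ℝ := fun t => (∫ s in (0 : ℝ)..L t, α t s) + σ₁ t - σ₀ t with hL'
  set N' : ℝ → ℝ := fun t =>
    (∫ s in (0 : ℝ)..L t, 2 * α t s * g t s) + g t (L t) * σ₁ t - g t 0 * σ₀ t with hN'
  have hLd : ∀ t ∈ Ico T₀ T, HasDerivWithinAt L (L' t) (Ico T₀ T) t := fun t ht => by
    simpa using (hσ t ht).2 0
  have hNd : ∀ t ∈ Ico T₀ T,
      HasDerivWithinAt (fun t => ∫ s in (0 : ℝ)..L t, g t s) (N' t) (Ico T₀ T) t := by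
    intro t ht
    have h := (hσ t ht).2 1
    simp only [pow_one, Nat.cast_one, one_add_one_eq_two] at h
    exact h
  have hL'0 : ∀ t ∈ Ico T₀ T, L' t ≤ 0 := fun t ht => by
    rw [← (hLd t ht).derivWithin (uniqueDiffOn_Ico T₀ T t ht)]
    exact hL.derivWithin_nonpos
  have hQd : ∀ t ∈ Ico T₀ T,
      HasDerivWithinAt Q ((N' t - Q t * L' t) / L t) (Ico T₀ T) t := by
    intro t ht
    have h := (hNd t ht).div (hLd t ht) (hl t ht).ne'
    have hQN : ∀ t, Q t = (∫ s in (0 : ℝ)..L t, g t s) / L t := fun t => by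
      rw [hQdef, meanVorticity, segIntegral, one_div, ← div_eq_inv_mul]
    refine (h.congr (fun s _ => hQN s) (hQN t)).congr_deriv ?_
    have := (hl t ht).ne'
    rw [hQN t]
    field_simp
  have hQ' : ∀ t ∈ Ico T₀ T, N' t - Q t * L' t ≤ constCV C₀ Cl * U t * Q t := by
    intro t ht
    have hαc : ContinuousOn (α t) (Icc 0 (L t)) := hu.continuousOn_stretchRate_segment (h0T t ht)
      (hx.vorticity_ne_zero t ht) (hx.continuousOn ht)
    have hgc : ContinuousOn (g t) (Icc 0 (L t)) :=
      ((hωc t ht).comp_continuousOn (hx.continuousOn ht)).norm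
    have e : ∫ s in (0 : ℝ)..L t, α t s * (2 * g t s - g t (L t))
        = (∫ s in (0 : ℝ)..L t, 2 * α t s * g t s) - g t (L t) * ∫ s in (0 : ℝ)..L t, α t s := by
      have i1 : IntervalIntegrable (fun s => 2 * α t s * g t s) volume 0 (L t) :=
        ((continuousOn_const.mul hαc).mul hgc).intervalIntegrable_of_Icc (hl t ht).le
      have i2 : IntervalIntegrable (fun s => g t (L t) * α t s) volume 0 (L t) :=
        (continuousOn_const.mul hαc).intervalIntegrable_of_Icc (hl t ht).le
      rw [← intervalIntegral.integral_const_mul, ← intervalIntegral.integral_sub i1 i2]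
      refine intervalIntegral.integral_congr fun s _ => ?_
      ring
    have h1 : (∫ s in (0 : ℝ)..L t, α t s * (2 * g t s - g t (L t)))
        + σ₀ t * (g t (L t) - g t 0) ≤ constCV C₀ Cl * U t * Q t := (hest t ht).1
    rw [e] at h1
    -- The only use of the monotone length: it allows replacing `Q` by the end value `g t (L t)` in
    -- front of `L'`, after which `σ₁` cancels.
    have h2 : 0 ≤ (g t (L t) - Q t) * -L' t :=
      mul_nonneg (sub_nonneg.2 (hQle t ht)) (neg_nonneg.2 (hL'0 t ht))
    simp only [hN', hL'] at h2 ⊢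
    linarith
  have hC1 : 0 < Real.exp C₀ / c₀ := div_pos (Real.exp_pos _) hc₀
  have hyd : ∀ t ∈ Ico T₀ T,
      HasDerivWithinAt y ((N' t - Q t * L' t) / L t / Q t) (Ico T₀ T) t := by
    intro t ht
    refine (((hQd t ht).const_mul (Real.exp C₀ / c₀)).log
      (mul_pos hC1 (hQpos t ht)).ne').congr_deriv ?_
    exact mul_div_mul_left _ _ hC1.ne'
  intro t₁ ht₁
  have hsub : Icc T₀ t₁ ⊆ Ico T₀ T := fun s hs => ⟨hs.1, hs.2.trans_lt ht₁.2⟩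
  have key : y t₁ ≤ y T₀ * Real.exp
      (∫ t' in T₀..t₁, Cu * max (constCU C₀) (constCV C₀ Cl) / L t') := by
    refine le_mul_exp_integral_of_hasDerivAt_le ht₁.1
      (fun t ht => ((hyd t (hsub ht)).mono hsub).continuousWithinAt)
      (y' := fun t => (N' t - Q t * L' t) / L t / Q t) (fun t ht => ?_) ?_ (fun t ht => ?_)
    · exact (hyd t (hsub ⟨ht.1.le, ht.2.le⟩)).hasDerivAt (Ico_mem_nhds ht.1 (ht.2.trans ht₁.2))
    -- Continuity of `L` is not assumed; it comes from its differentiability, the case `m = 0` of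
    -- the evolution formula.
    · refine continuousOn_const.div (fun t ht => ?_) fun t ht => (hl t (hsub ht)).ne'
      exact ((hLd t (hsub ht)).mono hsub).continuousWithinAt
    · have ht' := hsub ⟨ht.1.le, ht.2.le⟩
      have hQt := hQpos t ht'
      have hLt := hl t ht'
      rw [div_div, div_le_iff₀ (mul_pos hLt hQt)]
      calc N' t - Q t * L' t ≤ constCV C₀ Cl * U t * Q t := hQ' t ht'
        -- Only the `constCV` entry of the maximum is needed, since one bound `U` controls both
        -- `|u|` and `|u · ξ|`.
        _ ≤ max (constCU C₀) (constCV C₀ Cl) * (Cu * y t) * Q t := by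
          refine mul_le_mul_of_nonneg_right (mul_le_mul (le_max_right _ _) (hUy t ht') (hU0 t ht')
            ((constCV_nonneg hC₀.le hCl.le).trans (le_max_right _ _))) hQt.le
        _ = _ := by field_simp
  calc Omega u t₁ ≤ Real.exp C₀ / c₀ * Q t₁ := hΩQ t₁ ht₁
    _ = Real.exp (y t₁) := (Real.exp_log (mul_pos hC1 (hQpos t₁ ht₁))).symm
    _ ≤ _ := Real.exp_le_exp.2 key
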